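/- Let $d_x,d_y,N\ge 1$ be integers. Sequences of length $N$ are written $x=(x[1],\dots,x[N])$. A function $f:\mathbb{R}^{d_x\times N}\to\mathbb{R}^{d_y\times N}$ is *past-dependent* if for every $t$ there is a function $f[t]:\mathbb{R}^{d_x\times t}\to\mathbb{R}^{d_y}$ with $f(x)[t]=f[t](x[1],\dots,x[t])$ for all $x$. An *LSTM cell of width $d$* maps a sequence $(x[t])_{t\ge1}$ in $\mathbb{R}^d$ to the sequence $(h[t])_{t\ge1}$ in $\mathbb{R}^d$ given by $h[0]=c[0]=0$ and $$\begin{aligned} i[t+1]&=\sigma_{\mathrm{sig}}(W_ix[t+1]+U_ih[t]+b_i),& f[t+1]&=\sigma_{\mathrm{sig}}(W_fx[t+1]+U_fh[t]+b_f),\\ g[t+1]&=\tanh(W_gx[t+1]+U_gh[t]+b_g),& o[t+1]&=\sigma_{\mathrm{sig}}(W_ox[t+1]+U_oh[t]+b_o),\\ c[t+1]&=f[t+1]\odot c[t]+i[t+1]\odot g[t+1],& h[t+1]&=o[t+1]\odot\tanh(c[t+1]), \end{aligned}$$ with weights $W_*,U_*\in\mathbb{R}^{d\times d}$ and biases $b_*\in\mathbb{R}^d$,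 where $\sigma_{\mathrm{sig}}(z)=1/(1+e^{-z})$ and $\tanh$ act componentwise and $\odot$ is the componentwise product. A *deep LSTM of width $d$* is a map $\mathcal{N}=\mathcal{Q}\circ\mathcal{R}_L\circ\cdots\circ\mathcal{R}_1\circ\mathcal{P}$ on sequences of length $N$, where $L\ge2$, $\mathcal{R}_1,\dots,\mathcal{R}_L$ are LSTM cells of width $d$, and $\mathcal{P}(x)[t]=Px[t]$, $\mathcal{Q}(s)[t]=Qs[t]$ for matrices $P\in\mathbb{R}^{d\times d_x}$, $Q\in\mathbb{R}^{d_y\times d}$. 1. Let $f:\mathbb{R}^{d_x\times N}\to\mathbb{R}^{d_y\times N}$ be continuous and past-dependent. Then for every $\epsilon>0$ and every compact $K\subset\mathbb{R}^{d_x}$ there is a deep LSTM $\mathcal{N}$ of width $d_x+d_y+3$ such that $$\sup_{x\in K^N}\ \sup_{1\le t\le N}\ \|f(x)[t]-\mathcal{N}(x)[t]\|<\epsilon .$$ 2. Let $1\le p<\infty$, let $K\subset\mathbb{R}^{d_x}$ be compact, and let $f:\mathbb{R}^{d_x\times N}\to\mathbb{R}^{d_y\times N}$ be past-dependent (not necessarily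 continuous) with $f\in L^p(K^N,\mathbb{R}^{d_y\times N})$; this holds in particular if $f\in L^p(\mathbb{R}^{d_x\times N},\mathbb{R}^{d_y\times N})$, or if $f[t]\in L^p(\mathbb{R}^{d_x\times t},\mathbb{R}^{d_y})$ for every $t$. Then for every $\epsilon>0$ there is a deep LSTM $\mathcal{N}$ of width $\max\{d_x+1,d_y\}+1$ such that $$\sup_{1\le t\le N}\ \|f(x)[t]-\mathcal{N}(x)[t]\|_{L^p(K^N)}<\epsilon .$$ -/

import Mathlib

open MeasureTheory
open scoped ENNReal Matrix

/-- The parameters of an LSTM cell acting on hidden states in `ℝ ^ d`: for each of the input gate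
`i`, the forget gate `f`, the cell candidate `g` and the output gate `o`, two `d × d` weight
matrices and a bias vector. -/
structure LSTMCell (d : ℕ) where
  Wi : Matrix (Fin d) (Fin d) ℝ
  Ui : Matrix (Fin d) (Fin d) ℝ
  bi : Fin d → ℝ
  Wf : Matrix (Fin d) (Fin d) ℝ
  Uf : Matrix (Fin d) (Fin d) ℝ
  bf : Fin d → ℝ
  Wg : Matrix (Fin d) (Fin d) ℝ
  Ug : Matrix (Fin d) (Fin d) ℝ
  bg : Fin d → ℝ
  Wo : Matrix (Fin d) (Fin d) ℝ
  Uo : Matrix (Fin d) (Fin d) ℝ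
  bo : Fin d → ℝ

namespace LSTMCell

variable {d : ℕ}

/-- The input gate `i[t+1]`, from the hidden state `h = h[t]` and the input token `x = x[t+1]`. -/
noncomputable def inputGate (R : LSTMCell d) (h x : Fin d → ℝ) : Fin d → ℝ :=
  fun k => Real.sigmoid ((R.Wi *ᵥ x + R.Ui *ᵥ h + R.bi) k)

/-- The forget gate `f[t+1]`. -/
noncomputable def forgetGate (R : LSTMCell d) (h x : Fin d → ℝ) : Fin d → ℝ :=
  fun k => Real.sigmoid ((R.Wf *ᵥ x + R.Uf *ᵥ h + R.bf) k)

/-- The cell candidate `g[t+1]`. -/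
noncomputable def candidate (R : LSTMCell d) (h x : Fin d → ℝ) : Fin d → ℝ :=
  fun k => Real.tanh ((R.Wg *ᵥ x + R.Ug *ᵥ h + R.bg) k)

/-- The output gate `o[t+1]`. -/
noncomputable def outputGate (R : LSTMCell d) (h x : Fin d → ℝ) : Fin d → ℝ :=
  fun k => Real.sigmoid ((R.Wo *ᵥ x + R.Uo *ᵥ h + R.bo) k)

/-- The new cell state `c[t+1] = f[t+1] ⊙ c[t] + i[t+1] ⊙ g[t+1]`. -/
noncomputable def nextCell (R : LSTMCell d) (c h x : Fin d → ℝ) : Fin d → ℝ :=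
  R.forgetGate h x * c + R.inputGate h x * R.candidate h x

/-- The new hidden state `h[t+1] = o[t+1] ⊙ tanh (c[t+1])`. -/
noncomputable def nextHidden (R : LSTMCell d) (c h x : Fin d → ℝ) : Fin d → ℝ :=
  R.outputGate h x * fun k => Real.tanh (R.nextCell c h x k)

/-- The pair `(c, h)` after the first `t` tokens have been read, starting from zero.
The tokens `x[1], x[2], …` of the sequence are stored as `x 0, x 1, …`. -/
noncomputable def state (R : LSTMCell d) (x : ℕ → Fin d → ℝ) :
    ℕ → (Fin d → ℝ) × (Fin d → ℝ)
  | 0 => (0, 0)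
  | t + 1 => (R.nextCell (R.state x t).1 (R.state x t).2 (x t),
      R.nextHidden (R.state x t).1 (R.state x t).2 (x t))

/-- The sequence-to-sequence map of the cell: the output token at a given time is the hidden state
after the input token of the same time has been read. -/
noncomputable def apply (R : LSTMCell d) (x : ℕ → Fin d → ℝ) : ℕ → Fin d → ℝ :=
  fun t => (R.state x (t + 1)).2

end LSTMCell

/-- An LSTM network of width `d` from `dx`-dimensional to `dy`-dimensional tokens: the lifting
matrix `P`, the cells `R₁, …, R_L` (in the order in which they are applied) and the projection
matrix `Q`. -/
structure LSTMNetwork (dx dy d : ℕ) where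
  P : Matrix (Fin d) (Fin dx) ℝ
  cells : List (LSTMCell d)
  Q : Matrix (Fin dy) (Fin d) ℝ

namespace LSTMNetwork

variable {dx dy d N : ℕ}

/-- A network is deep if it has at least two cells. -/
def IsDeep (𝒩 : LSTMNetwork dx dy d) : Prop := 2 ≤ 𝒩.cells.length

/-- The lifting map, applied token by token. A sequence of length `N` is continued by zeros; as
each cell only looks at the past, this has no influence on the outputs at the first `N` times. -/
noncomputable def lift (𝒩 : LSTMNetwork dx dy d) (x : Fin N → EuclideanSpace ℝ (Fin dx)) :
    ℕ → Fin d → ℝ :=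
  fun t => if ht : t < N then 𝒩.P *ᵥ (x ⟨t, ht⟩).ofLp else 0

/-- The sequence-to-sequence function `Q ∘ R_L ∘ ⋯ ∘ R₁ ∘ P` on sequences of length `N`. -/
noncomputable def eval (𝒩 : LSTMNetwork dx dy d) (x : Fin N → EuclideanSpace ℝ (Fin dx)) :
    Fin N → EuclideanSpace ℝ (Fin dy) :=
  fun t => WithLp.toLp 2
    (𝒩.Q *ᵥ (𝒩.cells.foldl (fun s R => R.apply s) (𝒩.lift x)) (t : ℕ))

end LSTMNetwork

/-- A sequence-to-sequence function is past-dependent if its output at time `t` is a function of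
the inputs at the times up to and including `t`. -/
def PastDependent {dx dy N : ℕ}
    (f : (Fin N → EuclideanSpace ℝ (Fin dx)) → (Fin N → EuclideanSpace ℝ (Fin dy))) : Prop :=
  ∃ F : (t : Fin N) → ({s : Fin N // s ≤ t} → EuclideanSpace ℝ (Fin dx)) →
      EuclideanSpace ℝ (Fin dy),
    ∀ x t, f x t = F t (fun s => x s)

/-- The set `K ^ N` of sequences of length `N` with all tokens in `K`. -/
def seqSet {dx : ℕ} (N : ℕ) (K : Set (EuclideanSpace ℝ (Fin dx))) :
    Set (Fin N → EuclideanSpace ℝ (Fin dx)) :=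
  Set.univ.pi fun _ => K

/-! Consider the maps computed by LSTM cells followed by a linear map on tokens, and close this set
under locally uniform convergence. The closure is stable under composition, because the linear map
can be absorbed into the input weights of the next cell. If the candidate sees small inputs, where
`tanh` is linear, and the input gate sees very negative ones, where the sigmoid is an exponential,
then a single cell tends to a gated filter `y[t] = ∑ λ^(t-i) exp(L x[i] + l) (A x[i] + b)`
(`gatedFilter_mem_approximable`). Hence one slot of the token can be multiplied by `exp w`, where
`w` is a linear functional or a running sum of other slots. Conjugating a translation by this
multiplication gives `e^w (e^{-w} y + c) = y + c e^w`, so `c e^w` can be added to a slot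
(`addMap_constMulExp_mem`).

Composition adds such terms up. By Stone-Weierstrass, exponentials of an additive, point-separating
family span a dense space. Running sums with different `λ` separate the histories of the input, so
every continuous causal function can be added to a slot (`causal_mem_addable`). With separate slots
for input, output and scratch this is the first claim.

For the second claim input and output share slots, so all information passes through a single
number. An `L^p` causal function is close to a continuous causal one
(`exists_continuous_causal_near`). The latter almost factors through the natural number whose digits
are the quantized history and the time (`exists_code`). Replacing the quantizer by continuous
functions converging to it almost everywhere makes the code continuous at a small `L^p` cost
(`exists_continuous_code_near`). A narrow network writes the code into one slot, erases the input
and decodes token by token (`exists_isDeep_near_of_code`). -/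

open Filter Topology

/-! ### Causality of cells and absorption of linear maps -/

namespace LSTMCell

variable {d : ℕ}

theorem state_congr (R : LSTMCell d) {x y : ℕ → Fin d → ℝ} (t : ℕ)
    (h : ∀ s < t, x s = y s) : R.state x t = R.state y t := by
  induction t with
  | zero => rfl
  | succ t ih =>
    simp only [state, ih fun s hs => h s (hs.trans t.lt_succ_self), h t t.lt_succ_self]

theorem apply_congr (R : LSTMCell d) {x y : ℕ → Fin d → ℝ} (n : ℕ)
    (h : ∀ s < n, x s = y s) {t : ℕ} (ht : t < n) : R.apply x t = R.apply y t := by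
  rw [apply, apply, R.state_congr (t + 1) fun s hs => h s (by omega)]

theorem foldl_apply_congr (cs : List (LSTMCell d)) {x y : ℕ → Fin d → ℝ} (n : ℕ)
    (h : ∀ s < n, x s = y s) {t : ℕ} (ht : t < n) :
    cs.foldl (fun s R => R.apply s) x t = cs.foldl (fun s R => R.apply s) y t := by
  induction cs generalizing x y with
  | nil => exact h t ht
  | cons R cs ih => exact ih fun s hs => R.apply_congr n h hs

/-- The cell obtained by applying a linear map to the input tokens first. -/
def precomp (R : LSTMCell d) (S : Matrix (Fin d) (Fin d) ℝ) : LSTMCell d :=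
  { R with Wi := R.Wi * S, Wf := R.Wf * S, Wg := R.Wg * S, Wo := R.Wo * S }

theorem nextCell_precomp (R : LSTMCell d) (S : Matrix (Fin d) (Fin d) ℝ) (c h x : Fin d → ℝ) :
    (R.precomp S).nextCell c h x = R.nextCell c h (S *ᵥ x) := by
  funext k
  simp [nextCell, forgetGate, inputGate, candidate, precomp, Matrix.mulVec_mulVec]

theorem nextHidden_precomp (R : LSTMCell d) (S : Matrix (Fin d) (Fin d) ℝ)
    (c h x : Fin d → ℝ) :
    (R.precomp S).nextHidden c h x = R.nextHidden c h (S *ᵥ x) := by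
  funext k
  rw [nextHidden, nextHidden, nextCell_precomp]
  simp [outputGate, precomp, Matrix.mulVec_mulVec]

theorem apply_precomp (R : LSTMCell d) (S : Matrix (Fin d) (Fin d) ℝ) (x : ℕ → Fin d → ℝ) :
    (R.precomp S).apply x = R.apply fun t => S *ᵥ x t := by
  have h (t : ℕ) : (R.precomp S).state x t = R.state (fun t => S *ᵥ x t) t := by
    induction t with
    | zero => rfl
    | succ t ih =>
      simp only [state, ih, nextCell_precomp, nextHidden_precomp]
  funext t
  rw [apply, apply, h]

end LSTMCell

/-- A sequence of length `N`, continued by zeros. -/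
def zeroExtend {N d : ℕ} (x : Fin N → Fin d → ℝ) : ℕ → Fin d → ℝ :=
  fun t => if ht : t < N then x ⟨t, ht⟩ else 0

theorem zeroExtend_apply {N d : ℕ} (x : Fin N → Fin d → ℝ) (t : Fin N) :
    zeroExtend x t = x t := by
  simp [zeroExtend]

/-! ### Composition and limits of LSTM maps -/

section Approximable

variable {N d : ℕ}

/-- The sequence-to-sequence maps that are computed by at least `n` cells of width `d`, followed
by a linear map on tokens. -/
def realizable (N d n : ℕ) : Set C(Fin N → Fin d → ℝ, Fin N → Fin d → ℝ) :=
  {T | ∃ cs : List (LSTMCell d), n ≤ cs.length ∧ ∃ S : Matrix (Fin d) (Fin d) ℝ,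
    ∀ x t, T x t = S *ᵥ cs.foldl (fun s R => R.apply s) (zeroExtend x) (t : ℕ)}

/-- The matrix `S` between the two blocks goes into the input weights of the first cell of the
second block, which is why that block must be nonempty. The first block need not output zeros after
time `N`, but by causality this does not affect the first `N` outputs. -/
theorem realizable.comp {m n : ℕ} {T T' : C(Fin N → Fin d → ℝ, Fin N → Fin d → ℝ)}
    (h' : T' ∈ realizable N d (n + 1)) (h : T ∈ realizable N d m) :
    T'.comp T ∈ realizable N d (m + n + 1) := by
  obtain ⟨cs, hcs, S, hT⟩ := h
  obtain ⟨_ | ⟨R, cs'⟩, hcs', S', hT'⟩ := h'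
  · simp at hcs'
  refine ⟨cs ++ R.precomp S :: cs', by simp at hcs' ⊢; omega, S', fun x t => ?_⟩
  rw [ContinuousMap.comp_apply, hT', List.foldl_append, List.foldl_cons, List.foldl_cons,
    R.apply_precomp]
  congr 1
  refine LSTMCell.foldl_apply_congr cs' N (fun s hs => R.apply_congr N (fun s hs => ?_) hs) t.2
  rw [zeroExtend, dif_pos hs, hT]

/-- The sequence-to-sequence maps that are locally uniform limits of maps computed by LSTM cells
and linear maps on tokens. -/
def approximable (N d : ℕ) : Set C(Fin N → Fin d → ℝ, Fin N → Fin d → ℝ) :=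
  closure (realizable N d 1)

theorem isClosed_approximable : IsClosed (approximable N d) := isClosed_closure

/-- Composition is jointly continuous in the compact-open topology, as the sequence space is locally
compact. -/
theorem approximable.comp {T T' : C(Fin N → Fin d → ℝ, Fin N → Fin d → ℝ)}
    (h' : T' ∈ approximable N d) (h : T ∈ approximable N d) :
    T'.comp T ∈ closure (realizable N d 2) :=
  map_mem_closure₂ (f := fun T T' : C(Fin N → Fin d → ℝ, Fin N → Fin d → ℝ) => T'.comp T)
    ContinuousMap.continuous_comp' h h' fun _ ha _ hb => realizable.comp hb ha

theorem approximable.comp_mem {T T' : C(Fin N → Fin d → ℝ, Fin N → Fin d → ℝ)}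
    (h' : T' ∈ approximable N d) (h : T ∈ approximable N d) :
    T'.comp T ∈ approximable N d :=
  closure_mono (fun _ hT => hT.imp fun _ h => ⟨by have := h.1; omega, h.2⟩)
    (approximable.comp h' h)

/-- The network with lifting `P`, projection `Q` and an approximable map in between can be
approximated by deep networks, uniformly on compact sets. -/
theorem exists_isDeep_near {dx dy : ℕ} (hid : ContinuousMap.id _ ∈ approximable N d)
    {T : C(Fin N → Fin d → ℝ, Fin N → Fin d → ℝ)} (hT : T ∈ approximable N d)
    (P : Matrix (Fin d) (Fin dx) ℝ) (Q : Matrix (Fin dy) (Fin d) ℝ)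
    {K : Set (Fin N → EuclideanSpace ℝ (Fin dx))} (hK : IsCompact K) {ε : ℝ} (hε : 0 < ε) :
    ∃ 𝒩 : LSTMNetwork dx dy d, 𝒩.IsDeep ∧ ∀ x ∈ K, ∀ t,
      ‖WithLp.toLp 2 (Q *ᵥ T (fun s => P *ᵥ (x s).ofLp) t) - 𝒩.eval x t‖ < ε := by
  let pre : C(Fin N → EuclideanSpace ℝ (Fin dx), Fin N → Fin d → ℝ) :=
    ⟨fun x s => P *ᵥ (x s).ofLp, by fun_prop⟩
  let post : C(Fin N → Fin d → ℝ, Fin N → EuclideanSpace ℝ (Fin dy)) :=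
    ⟨fun y t => WithLp.toLp 2 (Q *ᵥ y t), by fun_prop⟩
  have hc : Continuous fun T : C(Fin N → Fin d → ℝ, Fin N → Fin d → ℝ) =>
      post.comp (T.comp pre) :=
    (ContinuousMap.continuous_postcomp _).comp (ContinuousMap.continuous_precomp _)
  -- Composing with the approximable identity supplies the second cell that depth requires.
  have hT2 : T ∈ closure (realizable N d 2) := by simpa using approximable.comp hid hT
  have htends := (ContinuousMap.tendsto_iff_forall_isCompact_tendstoUniformlyOn.1
    (hc.tendsto T)) K hK
  rw [Metric.tendstoUniformlyOn_iff] at htends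
  obtain ⟨T', hT', cs, hcs, S, hS⟩ := ((mem_closure_iff_frequently.1 hT2).and_eventually
    (htends ε hε)).exists.imp fun _ h => And.symm h
  refine ⟨⟨P, cs, Q * S⟩, hcs, fun x hx t => ?_⟩
  have := (dist_le_pi_dist _ _ t).trans_lt (hT' x hx)
  rw [dist_eq_norm] at this
  have heval : LSTMNetwork.eval ⟨P, cs, Q * S⟩ x t = (post.comp (T'.comp pre)) x t := by
    simp only [LSTMNetwork.eval, ContinuousMap.comp_apply, post, pre, ContinuousMap.coe_mk, hS,
      Matrix.mulVec_mulVec]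
    rfl
  rw [heval]
  exact this

end Approximable

/-! ### Gated filters as limits of single cells -/

section GatedFilter

variable {N d : ℕ}

/-- The cell without recurrent weights that has constant forget and output gates. -/
def LSTMCell.filterCell (φ : Fin d → ℝ) (L : Matrix (Fin d) (Fin d) ℝ) (l : Fin d → ℝ)
    (A : Matrix (Fin d) (Fin d) ℝ) (b : Fin d → ℝ) : LSTMCell d where
  Wi := L
  Ui := 0
  bi := l
  Wf := 0
  Uf := 0
  bf := φ
  Wg := A
  Ug := 0
  bg := b
  Wo := 0
  Uo := 0
  bo := 0

theorem LSTMCell.filterCell_state_fst (φ : Fin d → ℝ) (L : Matrix (Fin d) (Fin d) ℝ)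
    (l : Fin d → ℝ) (A : Matrix (Fin d) (Fin d) ℝ) (b : Fin d → ℝ) (x : ℕ → Fin d → ℝ) (t : ℕ)
    (j : Fin d) :
    ((filterCell φ L l A b).state x t).1 j =
      ∑ i ∈ Finset.range t, Real.sigmoid (φ j) ^ (t - 1 - i) *
        (Real.sigmoid ((L *ᵥ x i + l) j) * Real.tanh ((A *ᵥ x i + b) j)) := by
  induction t with
  | zero => rfl
  | succ t ih =>
    have h : ∀ i ∈ Finset.range t, Real.sigmoid (φ j) ^ (t + 1 - 1 - i) *
        (Real.sigmoid ((L *ᵥ x i + l) j) * Real.tanh ((A *ᵥ x i + b) j)) =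
        Real.sigmoid (φ j) * (Real.sigmoid (φ j) ^ (t - 1 - i) *
        (Real.sigmoid ((L *ᵥ x i + l) j) * Real.tanh ((A *ᵥ x i + b) j))) := fun i hi => by
      rw [← mul_assoc (Real.sigmoid (φ j)), ← pow_succ', show t - 1 - i + 1 = t + 1 - 1 - i by
        have := Finset.mem_range.1 hi; omega]
    rw [Finset.sum_range_succ, Finset.sum_congr rfl h, ← Finset.mul_sum, ← ih]
    simp [state, nextCell, forgetGate, inputGate, candidate, filterCell]

theorem LSTMCell.filterCell_apply (φ : Fin d → ℝ) (L : Matrix (Fin d) (Fin d) ℝ)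
    (l : Fin d → ℝ) (A : Matrix (Fin d) (Fin d) ℝ) (b : Fin d → ℝ) (x : Fin N → Fin d → ℝ)
    (t : Fin N) (j : Fin d) :
    (filterCell φ L l A b).apply (zeroExtend x) t j =
      2⁻¹ * Real.tanh (∑ i ∈ Finset.Iic t, Real.sigmoid (φ j) ^ ((t : ℕ) - i) *
        (Real.sigmoid ((L *ᵥ x i + l) j) * Real.tanh ((A *ᵥ x i + b) j))) := by
  have h : (filterCell φ L l A b).apply (zeroExtend x) t j = 2⁻¹ *
      Real.tanh (((filterCell φ L l A b).state (zeroExtend x) (t + 1)).1 j) := by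
    rw [LSTMCell.apply, state, nextHidden]
    simp [outputGate, filterCell, Real.sigmoid_zero]
  rw [h, filterCell_state_fst, Nat.range_succ_eq_Iic, ← Fin.map_valEmbedding_Iic, Finset.sum_map]
  simp [zeroExtend_apply]

/-- The sequence-to-sequence map `y[t] = ∑ i ≤ t, λ ^ (t - i) * exp (L x[i] + l) * (A x[i] + b)`. -/
noncomputable def gatedFilter (N : ℕ) {d : ℕ} (lam : Fin d → ℝ) (L : Matrix (Fin d) (Fin d) ℝ)
    (l : Fin d → ℝ) (A : Matrix (Fin d) (Fin d) ℝ) (b : Fin d → ℝ) :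
    C(Fin N → Fin d → ℝ, Fin N → Fin d → ℝ) where
  toFun x t j := ∑ i ∈ Finset.Iic t, lam j ^ ((t : ℕ) - i) *
    (Real.exp ((L *ᵥ x i + l) j) * (A *ᵥ x i + b) j)
  continuous_toFun := by fun_prop

theorem Real.hasDerivAt_tanh_zero : HasDerivAt Real.tanh 1 0 := by
  have h := (Real.hasDerivAt_sinh 0).div (Real.hasDerivAt_cosh 0) (by simp)
  have hf : Real.tanh = Real.sinh / Real.cosh := funext Real.tanh_eq_sinh_div_cosh
  rw [hf]
  simpa using h

theorem Real.continuous_tanh' : Continuous Real.tanh := by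
  simp_rw [funext Real.tanh_eq_sinh_div_cosh]
  exact Real.continuous_sinh.div Real.continuous_cosh fun x => (Real.cosh_pos x).ne'

/-- The function `tanh (ε * z) / ε`, extended by `z` at `ε = 0`. -/
noncomputable def scaledTanh (ε z : ℝ) : ℝ := dslope Real.tanh 0 (ε * z) * z

/-- Joint continuity through `ε = 0` is what later allows passing to the limit by currying. -/
theorem continuous_scaledTanh : Continuous fun p : ℝ × ℝ => scaledTanh p.1 p.2 := by
  have h : Continuous (dslope Real.tanh 0) := by
    rw [← continuousOn_univ, continuousOn_dslope univ_mem]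
    exact ⟨Real.continuous_tanh'.continuousOn, Real.hasDerivAt_tanh_zero.differentiableAt⟩
  unfold scaledTanh
  fun_prop

theorem scaledTanh_zero (z : ℝ) : scaledTanh 0 z = z := by
  simp [scaledTanh, Real.hasDerivAt_tanh_zero.deriv]

theorem mul_scaledTanh (ε z : ℝ) : ε * scaledTanh ε z = Real.tanh (ε * z) := by
  have h := sub_smul_dslope Real.tanh 0 (ε * z)
  simp only [sub_zero, smul_eq_mul, Real.tanh_zero] at h
  rw [← h, scaledTanh]
  ring

theorem Real.sigmoid_add_log {ε : ℝ} (hε : 0 < ε) (z : ℝ) :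
    Real.sigmoid (z + Real.log ε) = ε * (Real.exp z / (1 + ε * Real.exp z)) := by
  rw [Real.sigmoid_def, neg_add, Real.exp_add, Real.exp_neg, Real.exp_neg, Real.exp_log hε]
  have := Real.exp_pos z
  field_simp
  ring

/-- Gated filters are limits of maps that are computed by a single cell: small inputs are in the
linear regime of `tanh`, and very negative inputs in the exponential regime of the sigmoid. -/
theorem gatedFilter_mem_approximable (lam : Fin d → ℝ) (hlam : ∀ j, 0 ≤ lam j ∧ lam j < 1)
    (L : Matrix (Fin d) (Fin d) ℝ) (l : Fin d → ℝ) (A : Matrix (Fin d) (Fin d) ℝ)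
    (b : Fin d → ℝ) : gatedFilter N lam L l A b ∈ approximable N d := by
  -- A sigmoid never vanishes, so the forget gate is `lam j + ε` even when `lam j = 0`. The absolute
  -- values make the expression continuous on the whole line, although only `ε > 0` corresponds to a
  -- cell.
  let core (ε : ℝ) (x : Fin N → Fin d → ℝ) (t : Fin N) (j : Fin d) : ℝ :=
    ∑ i ∈ Finset.Iic t, (lam j + |ε|) ^ ((t : ℕ) - i) *
      (Real.exp ((L *ᵥ x i + l) j) / (1 + |ε| * Real.exp ((L *ᵥ x i + l) j)) *
        scaledTanh ε ((A *ᵥ x i + b) j))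
  have hτ {X : Type} [TopologicalSpace X] {f g : X → ℝ} (hf : Continuous f) (hg : Continuous g) :
      Continuous fun x => scaledTanh (f x) (g x) :=
    continuous_scaledTanh.comp (hf.prodMk hg)
  let Φ : C(ℝ × (Fin N → Fin d → ℝ), Fin N → Fin d → ℝ) :=
    { toFun := fun p t j => scaledTanh (p.1 ^ 2) (core p.1 p.2 t j)
      continuous_toFun := by
        refine continuous_pi fun t => continuous_pi fun j => hτ (by fun_prop) ?_
        refine continuous_finsetSum _ fun i _ => ?_
        refine Continuous.mul (by fun_prop) (Continuous.mul ?_ (hτ (by fun_prop) (by fun_prop)))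
        exact Continuous.div (by fun_prop) (by fun_prop) fun p => by positivity }
  have h0 : Φ.curry 0 = gatedFilter N lam L l A b := by
    ext x t j
    simp [Φ, core, gatedFilter, scaledTanh_zero]
  -- Joint continuity in `ε` and `x` gives, after currying, locally uniform convergence in `x`.
  have htends : Tendsto Φ.curry (𝓝[>] 0) (𝓝 (gatedFilter N lam L l A b)) := by
    rw [← h0]
    exact (Φ.curry.continuous.tendsto 0).mono_left nhdsWithin_le_nhds
  refine mem_closure_of_tendsto htends ?_
  have hsmall : ∀ᶠ ε : ℝ in 𝓝[>] 0, ∀ j, lam j + ε < 1 := by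
    refine eventually_all.2 fun j => nhdsWithin_le_nhds ?_
    have : Tendsto (fun ε : ℝ => lam j + ε) (𝓝 0) (𝓝 (lam j + 0)) := by
      exact (continuous_const.add continuous_id).tendsto 0
    exact this.eventually_lt_const (by simpa using (hlam j).2)
  filter_upwards [hsmall, self_mem_nhdsWithin] with ε hε1 hε0
  have hε0 : 0 < ε := hε0
  have hφ (j : Fin d) : ∃ φ, Real.sigmoid φ = lam j + ε := by
    have : lam j + ε ∈ Set.range Real.sigmoid := by
      rw [Real.range_sigmoid]
      exact ⟨by linarith [(hlam j).1], hε1 j⟩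
    exact this
  choose φ hφ using hφ
  -- The input gate and the candidate contribute one factor `ε` each, and the output gate is
  -- constantly `1/2`; the matrix `2 / ε ^ 2` undoes all three.
  refine ⟨[LSTMCell.filterCell φ L (fun j => l j + Real.log ε) (ε • A) (ε • b)], by simp,
    (2 / ε ^ 2) • 1, fun x t => ?_⟩
  funext j
  have hsum : ∑ i ∈ Finset.Iic t, Real.sigmoid (φ j) ^ ((t : ℕ) - i) *
      (Real.sigmoid ((L *ᵥ x i + fun j => l j + Real.log ε) j) *
        Real.tanh (((ε • A) *ᵥ x i + ε • b) j)) = ε ^ 2 * core ε x t j := by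
    rw [Finset.mul_sum]
    refine Finset.sum_congr rfl fun i _ => ?_
    have h1 : ((ε • A) *ᵥ x i + ε • b) j = ε * (A *ᵥ x i + b) j := by
      simp [Matrix.smul_mulVec, mul_add]
    have h2 : (L *ᵥ x i + fun j => l j + Real.log ε) j = (L *ᵥ x i + l) j + Real.log ε := by
      simp [add_assoc]
    rw [h1, h2, ← mul_scaledTanh, Real.sigmoid_add_log hε0, hφ, abs_of_pos hε0]
    ring
  rw [List.foldl_cons, List.foldl_nil, Matrix.smul_mulVec, Matrix.one_mulVec, Pi.smul_apply,
    LSTMCell.filterCell_apply, hsum, ← mul_scaledTanh]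
  simp only [ContinuousMap.curry_apply, ContinuousMap.coe_mk, smul_eq_mul, Φ]
  field_simp

end GatedFilter

/-! ### Adding to and multiplying single slots -/

section Slots

variable {N d m : ℕ}

theorem gatedFilter_apply_of_eq_zero {lam : Fin d → ℝ} (L : Matrix (Fin d) (Fin d) ℝ)
    (l : Fin d → ℝ) (A : Matrix (Fin d) (Fin d) ℝ) (b : Fin d → ℝ) (x : Fin N → Fin d → ℝ)
    (t : Fin N) {j : Fin d} (hj : lam j = 0) :
    gatedFilter N lam L l A b x t j = Real.exp ((L *ᵥ x t + l) j) * (A *ᵥ x t + b) j := by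
  simp only [gatedFilter, ContinuousMap.coe_mk, hj]
  rw [Finset.sum_eq_single_of_mem t (by simp) fun i hi hit => ?_]
  · simp
  · have : i < t := lt_of_le_of_ne (Finset.mem_Iic.1 hi) hit
    rw [zero_pow (by have : (i : ℕ) < t := this; omega), zero_mul]

theorem gatedFilter_zero_mem (L : Matrix (Fin d) (Fin d) ℝ)
    (l : Fin d → ℝ) (A : Matrix (Fin d) (Fin d) ℝ) (b : Fin d → ℝ) :
    gatedFilter N 0 L l A b ∈ approximable N d :=
  gatedFilter_mem_approximable 0 (fun _ => ⟨le_rfl, one_pos⟩) L l A b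

theorem id_mem_approximable : ContinuousMap.id _ ∈ approximable N d := by
  convert gatedFilter_zero_mem (N := N) (d := d) 0 0 1 0 using 1
  ext x t j
  simp [gatedFilter_apply_of_eq_zero]

/-- The entries of a sequence of tokens in the slots that are listed by `ix`. -/
def slots (N : ℕ) (ix : Fin m → Fin d) : C(Fin N → Fin d → ℝ, Fin N → Fin m → ℝ) where
  toFun x t i := x t (ix i)

/-- The map that sets the slots in `J` to zero. -/
def clear (N : ℕ) (J : Finset (Fin d)) : C(Fin N → Fin d → ℝ, Fin N → Fin d → ℝ) where
  toFun x t j := if j ∈ J then 0 else x t j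
  continuous_toFun := by
    refine continuous_pi fun t => continuous_pi fun j => ?_
    split_ifs <;> fun_prop

/-- The matrix of the map that sets the entries in `J` to zero. -/
def clearMatrix (J : Finset (Fin d)) : Matrix (Fin d) (Fin d) ℝ :=
  Matrix.diagonal fun j => if j ∈ J then 0 else 1

theorem clearMatrix_mulVec (J : Finset (Fin d)) (x : Fin d → ℝ) (j : Fin d) :
    (clearMatrix J *ᵥ x) j = if j ∈ J then 0 else x j := by
  simp [clearMatrix, Matrix.mulVec_diagonal]

theorem clear_mem_approximable (J : Finset (Fin d)) : clear N J ∈ approximable N d := by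
  convert gatedFilter_zero_mem (N := N) 0 0 (clearMatrix J) 0 using 1
  ext x t j
  simp [gatedFilter_apply_of_eq_zero, clearMatrix_mulVec, clear]

/-- A sequence of numbers, as a sequence of tokens with a single nonzero entry in slot `k`. -/
def inject (N : ℕ) (k : Fin d) : C(Fin N → ℝ, Fin N → Fin d → ℝ) where
  toFun v t j := if j = k then v t else 0
  continuous_toFun := by
    refine continuous_pi fun t => continuous_pi fun j => ?_
    split_ifs <;> fun_prop

/-- The map that sets the slots in `J` to zero and adds a function `U` of the slots `ix`. -/
def addMap (J : Finset (Fin d)) (ix : Fin m → Fin d) (U : C(Fin N → Fin m → ℝ, Fin N → Fin d → ℝ)) :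
    C(Fin N → Fin d → ℝ, Fin N → Fin d → ℝ) :=
  clear N J + U.comp (slots N ix)

/-- The map that sets the slots in `J` to zero and multiplies slot `k` by `exp ∘ w`, where `w` is a
function of the slots `ix`. -/
noncomputable def mulMap (J : Finset (Fin d)) (ix : Fin m → Fin d) (k : Fin d)
    (w : C(Fin N → Fin m → ℝ, Fin N → ℝ)) : C(Fin N → Fin d → ℝ, Fin N → Fin d → ℝ) where
  toFun x t j :=
    if j ∈ J then 0 else if j = k then Real.exp (w (slots N ix x) t) * x t j else x t j
  continuous_toFun := by
    refine continuous_pi fun t => continuous_pi fun j => ?_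
    split_ifs <;> fun_prop

theorem addMap_zero_mem (J : Finset (Fin d)) (ix : Fin m → Fin d) :
    addMap (N := N) J ix 0 ∈ approximable N d := by
  convert clear_mem_approximable J using 1
  ext x t j
  simp [addMap]

/-- The two maps are applied one after the other. As `U'` vanishes on the slots `ix`, the second
still reads the original data; as it vanishes on `J`, clearing `J` again loses nothing. -/
theorem addMap_add_mem {J : Finset (Fin d)} {ix : Fin m → Fin d} (hJ : ∀ i, ix i ∉ J)
    {U U' : C(Fin N → Fin m → ℝ, Fin N → Fin d → ℝ)} (hU : addMap J ix U ∈ approximable N d)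
    (hU' : addMap J ix U' ∈ approximable N d) (h0 : ∀ b t j, j ∈ J ∨ j ∈ Set.range ix → U' b t j = 0) :
    addMap J ix (U + U') ∈ approximable N d := by
  convert approximable.comp_mem hU hU' using 1
  have hs (x) : slots N ix (addMap J ix U' x) = slots N ix x := by
    ext t i
    simp [slots, addMap, clear, hJ, h0]
  ext x t j
  have hc : clear N J (addMap J ix U' x) t j = addMap J ix U' x t j := by
    by_cases hj : j ∈ J <;> simp [addMap, clear, hj, h0]
  calc addMap J ix (U + U') x t j
      = addMap J ix U' x t j + U (slots N ix x) t j := by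
        simp only [addMap, ContinuousMap.add_apply, ContinuousMap.comp_apply, Pi.add_apply]
        ring
    _ = _ := by
        rw [← hc, ← hs]
        rfl

theorem mulMap_zero_mem (J : Finset (Fin d)) (ix : Fin m → Fin d) (k : Fin d) :
    mulMap (N := N) J ix k 0 ∈ approximable N d := by
  convert clear_mem_approximable J using 1
  ext x t j
  simp [mulMap, clear]

theorem slots_mulMap {J : Finset (Fin d)} {ix : Fin m → Fin d} {k : Fin d} (hJ : ∀ i, ix i ∉ J)
    (hk : ∀ i, ix i ≠ k) (w : C(Fin N → Fin m → ℝ, Fin N → ℝ)) (x : Fin N → Fin d → ℝ) :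
    slots N ix (mulMap J ix k w x) = slots N ix x := by
  ext t i
  simp [slots, mulMap, hJ, hk]

theorem mulMap_add_mem {J : Finset (Fin d)} {ix : Fin m → Fin d} {k : Fin d} (hJ : ∀ i, ix i ∉ J)
    (hk : ∀ i, ix i ≠ k) {w w' : C(Fin N → Fin m → ℝ, Fin N → ℝ)}
    (hw : mulMap J ix k w ∈ approximable N d) (hw' : mulMap J ix k w' ∈ approximable N d) :
    mulMap J ix k (w + w') ∈ approximable N d := by
  convert approximable.comp_mem hw hw' using 1
  have hs := slots_mulMap hJ hk w'
  ext x t j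
  rw [ContinuousMap.comp_apply]
  conv_rhs => rw [mulMap]
  simp only [ContinuousMap.coe_mk, hs]
  by_cases hj : j ∈ J
  · simp [mulMap, hj]
  by_cases hjk : j = k
  · subst hjk
    simp [mulMap, hj, Real.exp_add]
    ring
  · simp [mulMap, hj, hjk]

/-- The composition of a sequence of numbers with the exponential function, times a constant. -/
noncomputable def constMulExp (c : ℝ) (w : C(Fin N → Fin m → ℝ, Fin N → ℝ)) :
    C(Fin N → Fin m → ℝ, Fin N → ℝ) where
  toFun b t := c * Real.exp (w b t)

/-- Adding `c * exp ∘ w` to a slot: conjugate the translation by `c` with the multiplication by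
`exp ∘ w`. -/
theorem addMap_constMulExp_mem {J : Finset (Fin d)} {ix : Fin m → Fin d} {k : Fin d}
    (hJ : ∀ i, ix i ∉ J) (hk : ∀ i, ix i ≠ k) (hkJ : k ∉ J)
    {w : C(Fin N → Fin m → ℝ, Fin N → ℝ)} (hw : mulMap J ix k w ∈ approximable N d)
    (hw' : mulMap J ix k (-w) ∈ approximable N d) (c : ℝ) :
    addMap J ix ((inject N k).comp (constMulExp c w)) ∈ approximable N d := by
  have hshift := gatedFilter_zero_mem (N := N) 0 0 1 (Pi.single k c)
  convert approximable.comp_mem hw (approximable.comp_mem hshift hw') using 1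
  have hs (x) (y) (hxy : ∀ t j, y t j = x t j + (Pi.single k c : Fin d → ℝ) j) :
      slots N ix y = slots N ix x := by
    ext t i
    simp [slots, hxy, hk]
  ext x t j
  set z := gatedFilter N 0 0 0 1 (Pi.single k c) (mulMap J ix k (-w) x) with hz
  have hz' (t j) : z t j = mulMap J ix k (-w) x t j + (Pi.single k c : Fin d → ℝ) j := by
    simp [hz, gatedFilter_apply_of_eq_zero]
  have hsz : slots N ix z = slots N ix x := (hs _ z hz').trans (slots_mulMap hJ hk _ x)
  rw [ContinuousMap.comp_apply, ContinuousMap.comp_apply, ← hz]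
  conv_rhs => rw [mulMap]
  simp only [ContinuousMap.coe_mk, hsz, hz']
  by_cases hj : j ∈ J
  · have : j ≠ k := fun h => hkJ (h ▸ hj)
    simp [addMap, clear, inject, hj, this]
  by_cases hjk : j = k
  · subst hjk
    simp [addMap, mulMap, clear, inject, hj, constMulExp, mul_add, ← mul_assoc, ← Real.exp_add]
    ring
  · simp [addMap, mulMap, clear, inject, hj, hjk]

/-- The row vector of the linear functional `a` on the slots `ix`. -/
def slotRow (ix : Fin m → Fin d) (a : Fin m → ℝ) : Fin d → ℝ :=
  fun j => ∑ i, if j = ix i then a i else 0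

theorem slotRow_dotProduct (ix : Fin m → Fin d) (a : Fin m → ℝ) (x : Fin d → ℝ) :
    slotRow ix a ⬝ᵥ x = ∑ i, a i * x (ix i) := by
  simp only [slotRow, dotProduct, Finset.sum_mul, ite_mul, zero_mul]
  rw [Finset.sum_comm]
  simp

/-- A linear functional, applied token by token. -/
def tokenwiseLinear (N : ℕ) (a : Fin m → ℝ) : C(Fin N → Fin m → ℝ, Fin N → ℝ) where
  toFun b t := ∑ i, a i * b t i

theorem Matrix.of_mulVec_apply (f : Fin d → Fin d → ℝ) (x : Fin d → ℝ) (j : Fin d) :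
    (Matrix.of f *ᵥ x) j = f j ⬝ᵥ x := rfl

theorem mulMap_tokenwiseLinear_mem (J : Finset (Fin d)) (ix : Fin m → Fin d) (k : Fin d)
    (a : Fin m → ℝ) : mulMap J ix k (tokenwiseLinear N a) ∈ approximable N d := by
  convert gatedFilter_zero_mem (N := N)
    (Matrix.of fun j => if j = k then slotRow ix a else 0) 0 (clearMatrix J) 0 using 1
  ext x t j
  rw [gatedFilter_apply_of_eq_zero _ _ _ _ _ _ rfl]
  simp only [Pi.add_apply, clearMatrix_mulVec, Matrix.of_mulVec_apply, Pi.zero_apply,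
    add_zero]
  by_cases hj : j ∈ J
  · simp [mulMap, hj]
  by_cases hjk : j = k
  · subst hjk
    simp [mulMap, hj, slotRow_dotProduct, tokenwiseLinear, slots]
  · simp [mulMap, hj, hjk]

/-- An exponentially weighted running sum of an affine functional of the tokens. -/
def runningSum (N : ℕ) (lam : ℝ) (a : Fin m → ℝ) (c : ℝ) : C(Fin N → Fin m → ℝ, Fin N → ℝ) where
  toFun b t := ∑ s ∈ Finset.Iic t, lam ^ ((t : ℕ) - s) * (∑ i, a i * b s i + c)

/-- One filter accumulates the sum in the scratch slot `r` and copies all other slots; a second one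
multiplies slot `k` by the exponential of slot `r` and clears `r`. -/
theorem mulMap_runningSum_mem {ix : Fin m → Fin d} {k r : Fin d}
    (hkr : k ≠ r) {lam : ℝ} (h0 : 0 ≤ lam) (h1 : lam < 1) (a : Fin m → ℝ) (c : ℝ) :
    mulMap {r} ix k (runningSum N lam a c) ∈ approximable N d := by
  have hG1 := gatedFilter_mem_approximable (N := N) (Pi.single r lam)
    (fun j => by rw [Pi.single_apply]; split_ifs <;> simp [h0, h1]) 0 0
    (Matrix.of fun j => if j = r then slotRow ix a else Pi.single j 1) (Pi.single r c)
  have hG2 := gatedFilter_zero_mem (N := N) (Matrix.of fun j => if j = k then Pi.single r 1 else 0)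
    0 (clearMatrix {r}) 0
  convert approximable.comp_mem hG2 hG1 using 1
  ext x t j
  rw [ContinuousMap.comp_apply, gatedFilter_apply_of_eq_zero _ _ _ _ _ _ rfl]
  simp only [Pi.add_apply, clearMatrix_mulVec, Matrix.of_mulVec_apply, Pi.zero_apply,
    add_zero, Finset.mem_singleton]
  by_cases hj : j = r
  · simp [mulMap, hj]
  rw [gatedFilter_apply_of_eq_zero _ _ _ _ _ _ (Pi.single_eq_of_ne hj _)]
  by_cases hjk : j = k
  · subst hjk
    simp [mulMap, hj, gatedFilter, Matrix.of_mulVec_apply, slotRow_dotProduct, runningSum, slots]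
  · simp [mulMap, hj, hjk, Matrix.of_mulVec_apply]

end Slots

/-! ### Stone-Weierstrass for exponentials and causal functions -/

section Density

/-- A closed set of continuous functions contains every function that can be approximated by its
elements uniformly on compact sets. -/
theorem ContinuousMap.mem_of_isClosed_of_near {X V : Type*} [TopologicalSpace X]
    [SeminormedAddCommGroup V] {S : Set C(X, V)} (hS : IsClosed S) (u : C(X, V))
    (h : ∀ K, IsCompact K → ∀ ε : ℝ, 0 < ε → ∃ g ∈ S, ∀ x ∈ K, ‖g x - u x‖ < ε) : u ∈ S := by
  rw [← hS.closure_eq, mem_closure_iff_nhds_basis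
    (nhds_basis_uniformity (Metric.uniformity_basis_dist.compactConvergenceUniformity))]
  rintro ⟨K, ε⟩ ⟨hK, hε⟩
  obtain ⟨g, hg, hgu⟩ := h K hK ε hε
  exact ⟨g, hg, fun x hx => by simpa [dist_eq_norm] using hgu x hx⟩

/-- The exponential function as a continuous map. -/
noncomputable def expMap : C(ℝ, ℝ) := ⟨Real.exp, Real.continuous_exp⟩

/-- The exponentials of an additive family of functions that separates points span a dense
subspace. -/
theorem exists_mem_span_exp_near {Y : Type*} [TopologicalSpace Y] (W : AddSubmonoid C(Y, ℝ))
    (hW : ∀ x y, x ≠ y → ∃ w ∈ W, w x ≠ w y) (f : C(Y, ℝ)) {K : Set Y} (hK : IsCompact K)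
    {ε : ℝ} (hε : 0 < ε) :
    ∃ g ∈ Submodule.span ℝ ((fun w => expMap.comp w) '' (W : Set C(Y, ℝ))),
      ∀ x ∈ K, ‖g x - f x‖ < ε := by
  let M : Submonoid C(Y, ℝ) :=
    { carrier := (fun w => expMap.comp w) '' (W : Set C(Y, ℝ))
      one_mem' := ⟨0, W.zero_mem, by ext; simp [expMap]⟩
      mul_mem' := by
        rintro _ _ ⟨v, hv, rfl⟩ ⟨w, hw, rfl⟩
        exact ⟨v + w, W.add_mem hv hw, by ext; simp [expMap, Real.exp_add]⟩ }
  have hsep : (Algebra.adjoin ℝ (M : Set C(Y, ℝ))).SeparatesPoints := by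
    intro x y hxy
    obtain ⟨w, hw, hne⟩ := hW x y hxy
    exact ⟨_, ⟨expMap.comp w, Algebra.subset_adjoin ⟨w, hw, rfl⟩, rfl⟩,
      fun h => hne (Real.exp_injective h)⟩
  obtain ⟨g, hg, hgf⟩ :=
    ContinuousMap.exists_mem_subalgebra_near_continuous_of_isCompact_of_separatesPoints
      hsep f hK hε
  refine ⟨g, ?_, hgf⟩
  -- The exponentials are closed under multiplication, so the algebra they generate is just their
  -- span.
  rw [← Subalgebra.mem_toSubmodule, Algebra.adjoin_eq_span, Submonoid.closure_eq] at hg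
  exact hg

variable {N d m : ℕ}

/-- The continuous functions of the slots `ix` that can be added to slot `k`. -/
def addable (N : ℕ) (J : Finset (Fin d)) (ix : Fin m → Fin d) (k : Fin d) :
    Set C(Fin N → Fin m → ℝ, Fin N → ℝ) :=
  {u | addMap J ix ((inject N k).comp u) ∈ approximable N d}

theorem isClosed_addable (J : Finset (Fin d)) (ix : Fin m → Fin d) (k : Fin d) :
    IsClosed (addable N J ix k) := by
  refine isClosed_approximable.preimage ?_
  exact continuous_const.add ((ContinuousMap.continuous_precomp _).comp
    (ContinuousMap.continuous_postcomp _))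

theorem zero_mem_addable (J : Finset (Fin d)) (ix : Fin m → Fin d) (k : Fin d) :
    0 ∈ addable N J ix k := by
  rw [addable, Set.mem_ofPred_eq, show (inject N k).comp (0 : C(Fin N → Fin m → ℝ, Fin N → ℝ)) = 0 by
    ext; simp [inject]]
  exact addMap_zero_mem J ix

theorem add_mem_addable {J : Finset (Fin d)} {ix : Fin m → Fin d} {k : Fin d}
    (hJ : ∀ i, ix i ∉ J) (hk : ∀ i, ix i ≠ k) (hkJ : k ∉ J)
    {u v : C(Fin N → Fin m → ℝ, Fin N → ℝ)} (hu : u ∈ addable N J ix k)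
    (hv : v ∈ addable N J ix k) : u + v ∈ addable N J ix k := by
  rw [addable, Set.mem_ofPred_eq, show (inject N k).comp (u + v) =
    (inject N k).comp u + (inject N k).comp v by
      ext x t j
      by_cases h : j = k <;> simp [inject, h]]
  refine addMap_add_mem hJ hu hv fun b t j hj => ?_
  have : j ≠ k := by
    rintro rfl
    rcases hj with hj | ⟨i, hi⟩
    · exact hkJ hj
    · exact hk i hi
  simp [inject, this]

/-- A continuous function, applied token by token. -/
def tokenwise (N : ℕ) (φ : C(Fin m → ℝ, ℝ)) : C(Fin N → Fin m → ℝ, Fin N → ℝ) where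
  toFun b t := φ (b t)

/-- Continuous functions of the current token can be added to a slot. -/
theorem tokenwise_mem_addable {J : Finset (Fin d)} {ix : Fin m → Fin d} {k : Fin d}
    (hJ : ∀ i, ix i ∉ J) (hk : ∀ i, ix i ≠ k) (hkJ : k ∉ J) (φ : C(Fin m → ℝ, ℝ)) :
    tokenwise N φ ∈ addable N J ix k := by
  let lin (a : Fin m → ℝ) : C(Fin m → ℝ, ℝ) := ⟨fun x => ∑ i, a i * x i, by fun_prop⟩
  let W : AddSubmonoid C(Fin m → ℝ, ℝ) :=
    { carrier := Set.range lin
      zero_mem' := ⟨0, by ext; simp [lin]⟩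
      add_mem' := by
        rintro _ _ ⟨a, rfl⟩ ⟨b, rfl⟩
        exact ⟨a + b, by ext; simp [lin, add_mul, Finset.sum_add_distrib]⟩ }
  have hW : ∀ x y : Fin m → ℝ, x ≠ y → ∃ w ∈ W, w x ≠ w y := by
    intro x y hxy
    obtain ⟨i, hi⟩ := Function.ne_iff.1 hxy
    refine ⟨lin (Pi.single i 1), ⟨_, rfl⟩, ?_⟩
    simpa [lin, Pi.single_apply] using hi
  have hspan : ∀ g ∈ Submodule.span ℝ ((fun w => expMap.comp w) '' (W : Set C(Fin m → ℝ, ℝ))),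
      tokenwise N g ∈ addable N J ix k := by
    intro g hg
    induction hg using Submodule.closure_induction with
    | zero =>
      have h : tokenwise N (0 : C(Fin m → ℝ, ℝ)) = 0 := by ext; simp [tokenwise]
      rw [h]
      exact zero_mem_addable J ix k
    | add x y _ _ hx hy =>
      have h : tokenwise N (x + y) = tokenwise N x + tokenwise N y := by ext; simp [tokenwise]
      rw [h]
      exact add_mem_addable hJ hk hkJ hx hy
    | smul_mem r x hx =>
      obtain ⟨_, ⟨a, rfl⟩, rfl⟩ := hx
      have hneg : -tokenwiseLinear N a = tokenwiseLinear N (-a) := by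
        ext; simp [tokenwiseLinear]
      have h : tokenwise N (r • expMap.comp (lin a)) = constMulExp r (tokenwiseLinear N a) := by
        ext b t
        simp [tokenwise, expMap, constMulExp, tokenwiseLinear, lin]
      rw [h]
      exact addMap_constMulExp_mem hJ hk hkJ (mulMap_tokenwiseLinear_mem (N := N) J ix k a)
        (hneg ▸ mulMap_tokenwiseLinear_mem J ix k (-a)) r
  refine ContinuousMap.mem_of_isClosed_of_near (isClosed_addable J ix k) _ fun K hK ε hε => ?_
  -- All tokens occurring in sequences of `K`; approximating `φ` on this set is enough.
  have hK' : IsCompact (⋃ t : Fin N, (fun b : Fin N → Fin m → ℝ => b t) '' K) :=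
    isCompact_iUnion fun t => hK.image (continuous_apply t)
  obtain ⟨g, hg, hgφ⟩ := exists_mem_span_exp_near W hW φ hK' hε
  refine ⟨_, hspan g hg, fun b hb => (pi_norm_lt_iff hε).2 fun t => ?_⟩
  exact hgφ _ (Set.mem_iUnion.2 ⟨t, b, hb, rfl⟩)

/-- A sequence-to-sequence function is causal if its output at time `t` is determined by the
inputs up to time `t`. -/
def Causal {α β : Type*} (u : (Fin N → α) → Fin N → β) : Prop :=
  ∀ x y t, (∀ s ≤ t, x s = y s) → u x t = u y t

theorem causal_runningSum (lam : ℝ) (a : Fin m → ℝ) (c : ℝ) : Causal (runningSum N lam a c) := by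
  intro x y t h
  refine Finset.sum_congr rfl fun s hs => ?_
  rw [h s (Finset.mem_Iic.1 hs)]

theorem neg_runningSum (lam : ℝ) (a : Fin m → ℝ) (c : ℝ) :
    -runningSum N lam a c = runningSum N lam (-a) (-c) := by
  ext b t
  simp only [runningSum, ContinuousMap.neg_apply, ContinuousMap.coe_mk, Pi.neg_apply,
    ← Finset.sum_neg_distrib, neg_mul]
  refine Finset.sum_congr rfl fun s _ => ?_
  rw [Finset.sum_neg_distrib]
  ring

/-- The running sum of the constant `1` with ratio `1/2` is a partial geometric sum, a clock that
increases strictly and ignores the input. -/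
theorem runningSum_clock_lt (b b' : Fin N → Fin m → ℝ) {t t' : Fin N} (h : t < t') :
    runningSum N 2⁻¹ 0 1 b t < runningSum N 2⁻¹ 0 1 b' t' := by
  have key (b : Fin N → Fin m → ℝ) (t : Fin N) :
      runningSum N 2⁻¹ 0 1 b t = ∑ i ∈ Finset.range (t + 1), (2⁻¹ : ℝ) ^ i := by
    rw [← Finset.sum_range_reflect, Nat.range_succ_eq_Iic, ← Fin.map_valEmbedding_Iic,
      Finset.sum_map]
    simp [runningSum]
  rw [key, key]
  refine Finset.sum_lt_sum_of_subset (i := (t' : ℕ)) ?_ (by simp) ?_ (by positivity)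
    fun _ _ _ => by positivity
  · have : (t : ℕ) < t' := h
    exact Finset.range_subset_range.2 (by omega)
  · have : (t : ℕ) < t' := h
    simp only [Finset.mem_range]
    omega

/-- The difference of the two running sums is a polynomial in `lam` whose coefficients are the
differences of the tokens. It cannot vanish on all of `[0, 1)` if one of these is nonzero. -/
theorem exists_runningSum_ne {b b' : Fin N → Fin m → ℝ} {s t : Fin N} (hs : s ≤ t)
    (h : b s ≠ b' s) : ∃ (lam : ℝ) (a : Fin m → ℝ), 0 ≤ lam ∧ lam < 1 ∧
      runningSum N lam a 0 b t ≠ runningSum N lam a 0 b' t := by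
  obtain ⟨i, hi⟩ := Function.ne_iff.1 h
  by_contra! hcon
  let p : Polynomial ℝ :=
    ∑ r ∈ Finset.Iic t, Polynomial.monomial ((t : ℕ) - r) (b r i - b' r i)
  have hp : p = 0 := by
    refine Polynomial.eq_zero_of_infinite_isRoot p
      ((Set.Ico_infinite (zero_lt_one (α := ℝ))).mono fun lam hlam => ?_)
    have := hcon lam (Pi.single i 1) hlam.1 hlam.2
    rw [← sub_eq_zero] at this
    simp only [runningSum, ContinuousMap.coe_mk, ← Finset.sum_sub_distrib, ← mul_sub] at this
    simp only [Set.mem_ofPred_eq, Polynomial.IsRoot, p, Polynomial.eval_finsetSum,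
      Polynomial.eval_monomial]
    rw [← this]
    refine Finset.sum_congr rfl fun r _ => ?_
    simp [Pi.single_apply, mul_comm]
  have hcoeff := congrArg (fun q => q.coeff ((t : ℕ) - s)) hp
  simp only [p, Polynomial.finsetSum_coeff, Polynomial.coeff_monomial, Polynomial.coeff_zero]
    at hcoeff
  rw [Finset.sum_eq_single_of_mem s (Finset.mem_Iic.2 hs) fun r hr hrs => ?_] at hcoeff
  · simp only [if_true] at hcoeff
    exact hi (sub_eq_zero.1 hcoeff)
  · refine if_neg fun heq => hrs (Fin.ext ?_)
    have h1 : r ≤ t := Finset.mem_Iic.1 hr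
    rw [Fin.le_def] at h1 hs
    omega

/-- Continuous causal functions can be added to a slot if there is another slot for scratch. -/
theorem causal_mem_addable {ix : Fin m → Fin d} {k r : Fin d} (hr : ∀ i, ix i ≠ r)
    (hk : ∀ i, ix i ≠ k) (hkr : k ≠ r) (u : C(Fin N → Fin m → ℝ, Fin N → ℝ)) (hu : Causal u) :
    u ∈ addable N {r} ix k := by
  have hJ : ∀ i, ix i ∉ ({r} : Finset (Fin d)) := fun i => by simpa using hr i
  have hkJ : k ∉ ({r} : Finset (Fin d)) := by simpa using hkr
  -- The same exponentials with the same coefficients must work at all times, so density cannot be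
  -- applied to each time separately. A point of `Y` is a time with a history up to that time, and a
  -- causal map becomes one scalar function on `Y`.
  let Y := {p : Fin N × (Fin N → Fin m → ℝ) // ∀ s, p.1 < s → p.2 s = 0}
  let ev (w : C(Fin N → Fin m → ℝ, Fin N → ℝ)) : C(Y, ℝ) :=
    ⟨fun p => w p.1.2 p.1.1, by
      have h : Continuous fun p : Fin N × (Fin N → ℝ) => p.2 p.1 :=
        continuous_prod_of_discrete_left.2 fun t => continuous_apply t
      exact h.comp (f := fun p : Y => (p.1.1, w p.1.2)) (by fun_prop)⟩
  -- Both `w` and `-w` are required, since the conjugation multiplies by `exp (-w)` and then by `exp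
  -- w`.
  let W : AddSubmonoid C(Y, ℝ) :=
    { carrier := {w' | ∃ w : C(Fin N → Fin m → ℝ, Fin N → ℝ), Causal w ∧ mulMap {r} ix k w ∈ approximable N d ∧
        mulMap {r} ix k (-w) ∈ approximable N d ∧ ev w = w'}
      zero_mem' := ⟨0, fun _ _ _ _ => rfl, mulMap_zero_mem _ _ _,
        by rw [neg_zero]; exact mulMap_zero_mem _ _ _, rfl⟩
      add_mem' := by
        rintro _ _ ⟨v, hv, hv1, hv2, rfl⟩ ⟨w, hw, hw1, hw2, rfl⟩
        refine ⟨v + w, fun x y t h => ?_, mulMap_add_mem hJ hk hv1 hw1, ?_, rfl⟩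
        · exact congrArg₂ (· + ·) (hv x y t h) (hw x y t h)
        · rw [neg_add]
          exact mulMap_add_mem hJ hk hv2 hw2 }
  have hmem {lam : ℝ} (h0 : 0 ≤ lam) (h1 : lam < 1) (a : Fin m → ℝ) (c : ℝ) :
      ev (runningSum N lam a c) ∈ W :=
    ⟨_, causal_runningSum lam a c, mulMap_runningSum_mem hkr h0 h1 a c,
      by rw [neg_runningSum]; exact mulMap_runningSum_mem hkr h0 h1 _ _, rfl⟩
  have hW : ∀ x y : Y, x ≠ y → ∃ w ∈ W, w x ≠ w y := by
    rintro ⟨⟨t, b⟩, hb⟩ ⟨⟨t', b'⟩, hb'⟩ hne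
    rcases lt_trichotomy t t' with htt | rfl | htt
    · exact ⟨_, hmem (by norm_num) (by norm_num) 0 1, (runningSum_clock_lt b b' htt).ne⟩
    · have hbb : b ≠ b' := fun h => hne (by subst h; rfl)
      obtain ⟨s, hs⟩ := Function.ne_iff.1 hbb
      have hst : s ≤ t := by
        by_contra hst
        exact hs ((hb s (not_le.1 hst)).trans (hb' s (not_le.1 hst)).symm)
      obtain ⟨lam, a, h0, h1, hlam⟩ := exists_runningSum_ne hst hs
      exact ⟨_, hmem h0 h1 a 0, hlam⟩
    · exact ⟨_, hmem (by norm_num) (by norm_num) 0 1, (runningSum_clock_lt b' b htt).ne'⟩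
  have hspan : ∀ g ∈ Submodule.span ℝ ((fun w => expMap.comp w) '' (W : Set C(Y, ℝ))),
      ∃ v ∈ addable N {r} ix k, Causal v ∧ ev v = g := by
    intro g hg
    induction hg using Submodule.closure_induction with
    | zero => exact ⟨0, zero_mem_addable _ _ _, fun _ _ _ _ => rfl, rfl⟩
    | add x y _ _ hx hy =>
      obtain ⟨v, hv, hvc, rfl⟩ := hx
      obtain ⟨w, hw, hwc, rfl⟩ := hy
      exact ⟨v + w, add_mem_addable hJ hk hkJ hv hw,
        fun x y t h => congrArg₂ (· + ·) (hvc x y t h) (hwc x y t h), rfl⟩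
    | smul_mem c x hx =>
      obtain ⟨_, ⟨w, hw, hw1, hw2, rfl⟩, rfl⟩ := hx
      exact ⟨constMulExp c w, addMap_constMulExp_mem hJ hk hkJ hw1 hw2 c,
        fun x y t h => congrArg (fun z => c * Real.exp z) (hw x y t h), rfl⟩
  refine ContinuousMap.mem_of_isClosed_of_near (isClosed_addable _ ix k) _ fun K hK ε hε => ?_
  let trunc (t : Fin N) (b : Fin N → Fin m → ℝ) : Y :=
    ⟨(t, fun s => if s ≤ t then b s else 0), fun s hs => if_neg (not_le.2 hs)⟩
  have htrunc (t : Fin N) : Continuous (trunc t) := by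
    refine Continuous.subtype_mk (continuous_const.prodMk (continuous_pi fun s => ?_)) _
    split_ifs <;> fun_prop
  have hK' : IsCompact (⋃ t : Fin N, trunc t '' K) :=
    isCompact_iUnion fun t => hK.image (htrunc t)
  obtain ⟨g, hg, hgu⟩ := exists_mem_span_exp_near W hW (ev u) hK' hε
  obtain ⟨v, hv, hvc, rfl⟩ := hspan g hg
  refine ⟨v, hv, fun b hb => (pi_norm_lt_iff hε).2 fun t => ?_⟩
  -- By causality, values at `b` and at its truncation agree at time `t`, which brings the estimate
  -- on `Y` back to sequences.
  have heq : ∀ s ≤ t, b s = (trunc t b).1.2 s := fun s hs => (if_pos hs).symm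
  rw [Pi.sub_apply, hvc _ _ t heq, hu _ _ t heq]
  exact hgu _ (Set.mem_iUnion.2 ⟨t, b, hb, rfl⟩)

/-- Functions that can be added to single slots can be added to several slots at once. -/
theorem addMap_sum_mem {dy : ℕ} {J : Finset (Fin d)} {ix : Fin m → Fin d} {iy : Fin dy → Fin d}
    (hJ : ∀ i, ix i ∉ J) (hxy : ∀ i j, ix i ≠ iy j) (hyJ : ∀ j, iy j ∉ J)
    (u : Fin dy → C(Fin N → Fin m → ℝ, Fin N → ℝ)) (hu : ∀ j, u j ∈ addable N J ix (iy j)) :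
    addMap J ix (∑ j, (inject N (iy j)).comp (u j)) ∈ approximable N d := by
  suffices ∀ s : Finset (Fin dy), addMap J ix (∑ j ∈ s, (inject N (iy j)).comp (u j)) ∈
      approximable N d from this _
  intro s
  induction s using Finset.cons_induction with
  | empty => exact addMap_zero_mem J ix
  | cons j s hj ih =>
    rw [Finset.sum_cons]
    refine addMap_add_mem hJ (hu j) ih fun b t l hl => ?_
    have hne : ∀ j, l ≠ iy j := by
      rintro j rfl
      rcases hl with hl | ⟨i, hi⟩
      · exact hyJ j hl
      · exact hxy i j hi
    simp [ContinuousMap.sum_apply, inject, hne]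

end Density

/-! ### Wide networks for continuous functions, narrow networks for codes -/

section Networks

variable {N d m dx dy : ℕ}

theorem PastDependent.causal {f : (Fin N → EuclideanSpace ℝ (Fin dx)) →
    (Fin N → EuclideanSpace ℝ (Fin dy))} (hf : PastDependent f) : Causal f := by
  obtain ⟨F, hF⟩ := hf
  intro x y t h
  rw [hF, hF]
  exact congrArg (F t) (funext fun s => h s s.2)

/-- The matrix that writes a token into the slots `ix`. -/
def writeMatrix (ix : Fin m → Fin d) : Matrix (Fin d) (Fin m) ℝ :=
  Matrix.of fun k i => if k = ix i then 1 else 0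

theorem writeMatrix_mulVec {ix : Fin m → Fin d} (hix : Function.Injective ix) (z : Fin m → ℝ)
    (i : Fin m) : (writeMatrix ix *ᵥ z) (ix i) = z i := by
  simp [writeMatrix, Matrix.mulVec, dotProduct, hix.eq_iff]

theorem writeMatrix_mulVec_of_ne {ix : Fin m → Fin d} (z : Fin m → ℝ) {k : Fin d}
    (hk : ∀ i, ix i ≠ k) : (writeMatrix ix *ᵥ z) k = 0 := by
  simp [writeMatrix, Matrix.mulVec, dotProduct, fun i => (hk i).symm]

theorem slots_writeMatrix {ix : Fin m → Fin d} (hix : Function.Injective ix)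
    (x : Fin N → Fin m → ℝ) : slots N ix (fun s => writeMatrix ix *ᵥ x s) = x := by
  ext t i
  exact writeMatrix_mulVec hix _ _

theorem transpose_writeMatrix_mulVec (iy : Fin m → Fin d) (v : Fin d → ℝ) (j : Fin m) :
    ((writeMatrix iy)ᵀ *ᵥ v) j = v (iy j) := by
  simp [writeMatrix, Matrix.mulVec, dotProduct]

theorem addMap_sum_apply {J : Finset (Fin d)} {ix : Fin m → Fin d} {iy : Fin dy → Fin d}
    (hiy : Function.Injective iy) (hyJ : ∀ j, iy j ∉ J)
    (u : Fin dy → C(Fin N → Fin m → ℝ, Fin N → ℝ)) (x : Fin N → Fin d → ℝ) (t : Fin N)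
    (j : Fin dy) : addMap J ix (∑ j, (inject N (iy j)).comp (u j)) x t (iy j) =
      x t (iy j) + u j (slots N ix x) t := by
  simp [addMap, clear, hyJ, ContinuousMap.sum_apply, inject, hiy.eq_iff]

/-- Continuous past-dependent functions are approximated by networks that have one slot for each
coordinate of the input and of the output, and at least one further slot. -/
theorem exists_isDeep_near_of_continuous
    {f : (Fin N → EuclideanSpace ℝ (Fin dx)) → (Fin N → EuclideanSpace ℝ (Fin dy))}
    (hfc : Continuous f) (hf : Causal f) {K : Set (Fin N → EuclideanSpace ℝ (Fin dx))}
    (hK : IsCompact K) {ε : ℝ} (hε : 0 < ε) :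
    ∃ 𝒩 : LSTMNetwork dx dy (dx + dy + 3), 𝒩.IsDeep ∧ ∀ x ∈ K, ∀ t, ‖f x t - 𝒩.eval x t‖ < ε := by
  -- Slots for the input come first, then those for the output, then the scratch slot `r`; two slots
  -- stay idle.
  let ix (i : Fin dx) : Fin (dx + dy + 3) := ⟨i, by omega⟩
  let iy (j : Fin dy) : Fin (dx + dy + 3) := ⟨dx + j, by omega⟩
  let r : Fin (dx + dy + 3) := ⟨dx + dy, by omega⟩
  have hix : Function.Injective ix := fun i i' h => by simpa [ix, Fin.ext_iff] using h
  have hiy : Function.Injective iy := fun i i' h => by simpa [iy, Fin.ext_iff] using h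
  have hxy (i j) : ix i ≠ iy j := by simp [ix, iy]; omega
  have hxr (i) : ix i ≠ r := by simp [ix, r]; omega
  have hyr (j) : iy j ≠ r := by simp [iy, r]; omega
  let u (j : Fin dy) : C(Fin N → Fin dx → ℝ, Fin N → ℝ) :=
    ⟨fun b t => f (fun s => WithLp.toLp 2 (b s)) t j, by fun_prop⟩
  have hu (j) : u j ∈ addable N {r} ix (iy j) := by
    refine causal_mem_addable hxr (hxy · j) (hyr j) (u j) fun x y t h => ?_
    exact congrArg (· j) (hf _ _ t fun s hs => congrArg _ (h s hs))
  have hyJ : ∀ j, iy j ∉ ({r} : Finset _) := fun j => by simpa using hyr j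
  have hT := addMap_sum_mem (fun i => by simpa using hxr i) hxy hyJ u hu
  obtain ⟨𝒩, hdeep, h𝒩⟩ := exists_isDeep_near id_mem_approximable hT (writeMatrix ix)
    (writeMatrix iy)ᵀ hK hε
  refine ⟨𝒩, hdeep, fun x hx t => ?_⟩
  convert h𝒩 x hx t using 3
  ext j
  simp only [transpose_writeMatrix_mulVec]
  rw [addMap_sum_apply hiy hyJ, slots_writeMatrix hix, writeMatrix_mulVec_of_ne _ (hxy · j),
    zero_add]
  rfl

/-- Functions that factor through a single causal code are approximated by narrow networks. -/
theorem exists_isDeep_near_of_code {u : (Fin N → EuclideanSpace ℝ (Fin dx)) → Fin N → ℝ}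
    (huc : Continuous u) (hu : Causal u) {Ψ : ℝ → EuclideanSpace ℝ (Fin dy)} (hΨ : Continuous Ψ)
    {K : Set (Fin N → EuclideanSpace ℝ (Fin dx))} (hK : IsCompact K) {ε : ℝ} (hε : 0 < ε) :
    ∃ 𝒩 : LSTMNetwork dx dy (max (dx + 1) dy + 1), 𝒩.IsDeep ∧
      ∀ x ∈ K, ∀ t, ‖Ψ (u x t) - 𝒩.eval x t‖ < ε := by
  have hd1 : dx + 1 < max (dx + 1) dy + 1 := by omega
  have hd2 : dy < max (dx + 1) dy + 1 := by omega
  generalize max (dx + 1) dy + 1 = d at hd1 hd2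
  -- Slot `0` holds the code. Input and output both start at slot `1` and overlap, and an output
  -- slot may coincide with the scratch slot `r`.
  let ix (i : Fin dx) : Fin d := ⟨i + 1, by omega⟩
  let iy (j : Fin dy) : Fin d := ⟨j + 1, by omega⟩
  let s : Fin d := ⟨0, by omega⟩
  let r : Fin d := ⟨dx + 1, by omega⟩
  let is (_ : Fin 1) : Fin d := s
  have hix : Function.Injective ix := fun i i' h => by simpa [ix, Fin.ext_iff] using h
  have hiy : Function.Injective iy := fun i i' h => by simpa [iy, Fin.ext_iff] using h
  have hxr (i) : ix i ≠ r := by simp [ix, r]; omega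
  have hxs (i) : ix i ≠ s := by simp [ix, s]
  have hys (j) : iy j ≠ s := by simp [iy, s]
  have hsr : s ≠ r := by simp [s, r]
  let u' : C(Fin N → Fin dx → ℝ, Fin N → ℝ) :=
    ⟨fun b => u fun s => WithLp.toLp 2 (b s), by fun_prop⟩
  have henc : u' ∈ addable N {r} ix s :=
    causal_mem_addable hxr hxs hsr u' fun x y t h => hu _ _ t fun s hs => congrArg _ (h s hs)
  let Ψ' (j : Fin dy) : C(Fin N → Fin 1 → ℝ, Fin N → ℝ) :=
    tokenwise N ⟨fun z => Ψ (z 0) j, by fun_prop⟩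
  -- Decoding looks at the current token only, so it needs no scratch slot.
  have hΨ' (j) : Ψ' j ∈ addable N ∅ is (iy j) :=
    tokenwise_mem_addable (by simp) (fun _ => (hys j).symm) (by simp) _
  have hdec := addMap_sum_mem (by simp) (fun _ j => (hys j).symm) (by simp) Ψ' hΨ'
  -- Encode, erase everything except the code, decode.
  have hT := approximable.comp_mem hdec
    (approximable.comp_mem (clear_mem_approximable {s}ᶜ) henc)
  obtain ⟨𝒩, hdeep, h𝒩⟩ := exists_isDeep_near id_mem_approximable hT (writeMatrix ix)
    (writeMatrix iy)ᵀ hK hε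
  refine ⟨𝒩, hdeep, fun x hx t => ?_⟩
  convert h𝒩 x hx t using 3
  ext j
  simp only [transpose_writeMatrix_mulVec, ContinuousMap.comp_apply]
  rw [addMap_sum_apply hiy (by simp)]
  set X : Fin N → Fin d → ℝ := fun s => writeMatrix ix *ᵥ (x s).ofLp with hX
  have h1 (t) : addMap {r} ix ((inject N s).comp u') X t s = u x t := by
    simp only [addMap, ContinuousMap.add_apply, ContinuousMap.comp_apply, Pi.add_apply, clear,
      inject, ContinuousMap.coe_mk, if_true, Finset.mem_singleton, hsr, if_false]
    rw [hX, slots_writeMatrix hix]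
    beta_reduce
    rw [writeMatrix_mulVec_of_ne _ hxs, zero_add]
    rfl
  have h2 (y : Fin N → Fin d → ℝ) : clear N {s}ᶜ y t (iy j) = 0 := by
    simp [clear, hys j]
  rw [h2, zero_add]
  simp [Ψ', tokenwise, slots, clear, h1]

end Networks

/-! ### Continuous causal functions are dense in `L^p` -/

section CausalApproximation

variable {N : ℕ} {E : Type*}

/-- The sequence that agrees with `x` up to time `t`, and with `y` afterwards. -/
def splice (t : Fin N) (x y : Fin N → E) : Fin N → E := fun s => if s ≤ t then x s else y s

theorem continuous_splice [TopologicalSpace E] (t : Fin N) :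
    Continuous fun p : (Fin N → E) × (Fin N → E) => splice t p.1 p.2 := by
  refine continuous_pi fun s => ?_
  unfold splice
  split_ifs <;> fun_prop

theorem measurable_splice [MeasurableSpace E] (t : Fin N) :
    Measurable fun p : (Fin N → E) × (Fin N → E) => splice t p.1 p.2 := by
  refine measurable_pi_lambda _ fun s => ?_
  unfold splice
  split_ifs <;> fun_prop

/-- The preimage of a box is a product of two boxes, and each coordinate contributes one factor of
the box and one factor `ν univ`. Boxes determine the product measure. -/
theorem map_splice [MeasurableSpace E] (ν : Measure E) [IsFiniteMeasure ν] (t : Fin N) :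
    ((Measure.pi fun _ : Fin N => ν).prod (Measure.pi fun _ : Fin N => ν)).map
      (fun p => splice t p.1 p.2) =
    (Measure.pi (fun _ : Fin N => ν) Set.univ) • Measure.pi fun _ : Fin N => ν := by
  set μ := Measure.pi fun _ : Fin N => ν with hμ
  rcases eq_or_ne (μ Set.univ) 0 with h0 | h0
  · rw [h0, zero_smul, Measure.measure_univ_eq_zero.1 h0]
    simp
  have hfin : μ Set.univ ≠ ∞ := measure_ne_top _ _
  have key : μ = (μ Set.univ)⁻¹ • (μ.prod μ).map (fun p => splice t p.1 p.2) := by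
    refine Measure.pi_eq fun s hs => ?_
    have hpre : (fun p : (Fin N → E) × (Fin N → E) => splice t p.1 p.2) ⁻¹' Set.univ.pi s =
        (Set.univ.pi fun i => if i ≤ t then s i else Set.univ) ×ˢ
          (Set.univ.pi fun i => if i ≤ t then Set.univ else s i) := by
      ext ⟨x, y⟩
      simp only [Set.mem_preimage, Set.mem_univ_pi, Set.mem_prod, splice, ← forall_and]
      refine forall_congr' fun i => ?_
      split_ifs <;> simp
    rw [Measure.smul_apply, Measure.map_apply (measurable_splice t) (MeasurableSet.univ_pi hs),
      hpre, Measure.prod_prod, hμ, Measure.pi_pi, Measure.pi_pi, Measure.pi_univ,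
      ← Finset.prod_mul_distrib]
    have : ∀ i, ν (if i ≤ t then s i else Set.univ) * ν (if i ≤ t then Set.univ else s i) =
        ν Set.univ * ν (s i) := fun i => by
      split_ifs
      · exact mul_comm _ _
      · rfl
    simp_rw [this, Finset.prod_mul_distrib]
    rw [smul_eq_mul, ← mul_assoc, ENNReal.inv_mul_cancel, one_mul]
    · rwa [hμ, Measure.pi_univ] at h0
    · rwa [hμ, Measure.pi_univ] at hfin
  conv_rhs => enter [2]; rw [key]
  rw [smul_smul, ENNReal.mul_inv_cancel h0 hfin, one_smul]

/-- If `F` only depends on the tokens up to time `t`, then the tokens after time `t` can be fixed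
in an approximation of `F` without increasing the error. -/
theorem exists_eLpNorm_sub_splice_le [MeasurableSpace E] [Nonempty E] {V : Type*}
    [NormedAddCommGroup V] (ν : Measure E) [IsFiniteMeasure ν] {p : ℝ≥0∞} (hp0 : p ≠ 0)
    (hp : p ≠ ∞) (t : Fin N) {F g : (Fin N → E) → V}
    (hF : ∀ x y, (∀ s ≤ t, x s = y s) → F x = F y)
    (hmeas : AEStronglyMeasurable (fun x => F x - g x) (Measure.pi fun _ : Fin N => ν)) :
    ∃ y, eLpNorm (fun x => F x - g (splice t x y)) p (Measure.pi fun _ : Fin N => ν) ≤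
      eLpNorm (fun x => F x - g x) p (Measure.pi fun _ : Fin N => ν) := by
  have hmap := map_splice ν t
  set μ := Measure.pi fun _ : Fin N => ν with hμ
  rcases eq_or_ne μ 0 with h0 | h0
  · obtain ⟨e⟩ := ‹Nonempty E›
    exact ⟨fun _ => e, by simp [h0]⟩
  have hne : μ Set.univ ≠ 0 := Measure.measure_univ_ne_zero.2 h0
  have hfin : μ Set.univ ≠ ∞ := measure_ne_top _ _
  let h (x : Fin N → E) : ℝ≥0∞ := ‖F x - g x‖ₑ ^ p.toReal
  have hh : AEMeasurable h ((μ.prod μ).map fun p => splice t p.1 p.2) := by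
    rw [hmap]
    exact (hmeas.enorm.pow_const _).smul_measure _
  have hh' : AEMeasurable (fun p : (Fin N → E) × (Fin N → E) => h (splice t p.1 p.2))
      (μ.prod μ) := hh.comp_measurable (measurable_splice t)
  have hint : ∫⁻ y, ∫⁻ x, h (splice t x y) ∂μ ∂μ = μ Set.univ * ∫⁻ x, h x ∂μ := by
    rw [← lintegral_prod_symm _ hh', ← lintegral_map' hh (measurable_splice t).aemeasurable, hmap,
      lintegral_smul_measure, smul_eq_mul]
  -- The `p`-th power of the error at `splice t x y`, averaged over `y`, is the original one by
  -- `map_splice`; some `y` does not exceed the average.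
  obtain ⟨y, hy⟩ := exists_le_laverage h0 hh'.lintegral_prod_left'
  refine ⟨y, ?_⟩
  rw [laverage_eq, hint, mul_comm, ENNReal.mul_div_cancel_right hne hfin] at hy
  rw [eLpNorm_eq_lintegral_rpow_enorm_toReal hp0 hp, eLpNorm_eq_lintegral_rpow_enorm_toReal hp0 hp]
  refine ENNReal.rpow_le_rpow (le_trans (le_of_eq ?_) hy) (by positivity)
  refine lintegral_congr fun x => ?_
  simp only [h]
  rw [hF (splice t x y) x fun s hs => if_pos hs]

/-- Causal functions in `L^p` are approximated by continuous causal functions. -/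
theorem exists_continuous_causal_near {dx dy : ℕ} (ν : Measure (EuclideanSpace ℝ (Fin dx)))
    [IsFiniteMeasure ν] {p : ℝ≥0∞} (hp0 : p ≠ 0) (hp : p ≠ ∞)
    {f : (Fin N → EuclideanSpace ℝ (Fin dx)) → (Fin N → EuclideanSpace ℝ (Fin dy))}
    (hf : Causal f) (hfp : MemLp f p (Measure.pi fun _ : Fin N => ν)) {δ : ℝ≥0∞} (hδ : δ ≠ 0) :
    ∃ g : (Fin N → EuclideanSpace ℝ (Fin dx)) → (Fin N → EuclideanSpace ℝ (Fin dy)),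
      Continuous g ∧ Causal g ∧
      ∀ t, eLpNorm (fun x => f x t - g x t) p (Measure.pi fun _ : Fin N => ν) ≤ δ := by
  have key (t : Fin N) : ∃ g : (Fin N → EuclideanSpace ℝ (Fin dx)) → EuclideanSpace ℝ (Fin dy),
      Continuous g ∧ (∀ x y, (∀ s ≤ t, x s = y s) → g x = g y) ∧
      eLpNorm (fun x => f x t - g x) p (Measure.pi fun _ : Fin N => ν) ≤ δ := by
    obtain ⟨g, hg, -⟩ := (memLp_pi_iff.1 hfp t).exists_boundedContinuous_eLpNorm_sub_le hp hδ
    obtain ⟨y, hy⟩ := exists_eLpNorm_sub_splice_le ν hp0 hp t (F := fun x => f x t) (g := g)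
      (fun x y h => hf x y t h)
      ((memLp_pi_iff.1 hfp t).1.sub g.continuous.aestronglyMeasurable)
    refine ⟨fun x => g (splice t x y), ?_, fun x x' h => ?_, hy.trans hg⟩
    · exact g.continuous.comp ((continuous_splice t).comp (continuous_id.prodMk continuous_const))
    · refine congrArg g (funext fun s => ?_)
      by_cases hs : s ≤ t <;> simp [splice, hs, h]
  choose g hgc hg hgf using key
  exact ⟨fun x t => g t x, continuous_pi hgc, fun x y t h => hg t x y h, hgf⟩

end CausalApproximation

/-! ### Coding quantized histories by a real number -/

section Code

variable {N : ℕ}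

/-- The number with the digits `z 0, …, z t` to base `B`, together with the time `t`. -/
def codeAt (B : ℕ) (t : Fin N) (z : Fin N → ℝ) : ℝ :=
  ∑ s ∈ Finset.Iic t, z s * (B : ℝ) ^ (s : ℕ) + t * (B : ℝ) ^ N

theorem continuous_codeAt (B : ℕ) (t : Fin N) : Continuous (codeAt B t) := by
  unfold codeAt
  fun_prop

theorem codeAt_congr (B : ℕ) (t : Fin N) {z z' : Fin N → ℝ} (h : ∀ s ≤ t, z s = z' s) :
    codeAt B t z = codeAt B t z' := by
  refine congrArg (· + _) (Finset.sum_congr rfl fun s hs => ?_)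
  rw [h s (Finset.mem_Iic.1 hs)]

theorem codeAt_eq_natCast {B : ℕ} (t : Fin N) (q : Fin N → Fin (B + 1)) :
    codeAt (B + 1) t (fun s => ((q s : ℕ) : ℝ)) =
      ((finFunctionFinEquiv (fun s => if s ≤ t then q s else 0) + (t : ℕ) * (B + 1) ^ N : ℕ) : ℝ) := by
  rw [finFunctionFinEquiv_apply, codeAt]
  push_cast
  congr 1
  rw [← Finset.sum_subset (Finset.subset_univ (Finset.Iic t)) fun s _ hs => ?_]
  · refine Finset.sum_congr rfl fun s hs => ?_
    rw [if_pos (Finset.mem_Iic.1 hs)]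
  · rw [if_neg fun h => hs (Finset.mem_Iic.2 h)]
    simp

/-- The digits make up a number below `(B + 1) ^ N`, so the quotient by this power is the time and
the remainder determines the digits. -/
theorem codeAt_injective {B : ℕ} {t t' : Fin N} {q q' : Fin N → Fin (B + 1)}
    (h : codeAt (B + 1) t (fun s => ((q s : ℕ) : ℝ)) =
      codeAt (B + 1) t' fun s => ((q' s : ℕ) : ℝ)) : t = t' ∧ ∀ s ≤ t, q s = q' s := by
  rw [codeAt_eq_natCast, codeAt_eq_natCast, Nat.cast_inj] at h
  set a := finFunctionFinEquiv (fun s => if s ≤ t then q s else 0) with ha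
  set a' := finFunctionFinEquiv (fun s => if s ≤ t' then q' s else 0) with ha'
  have hpos : 0 < (B + 1) ^ N := by positivity
  have htt : (t : ℕ) = t' := by
    have := congrArg (· / (B + 1) ^ N) h
    simpa [Nat.add_mul_div_right _ _ hpos, Nat.div_eq_of_lt a.2, Nat.div_eq_of_lt a'.2] using this
  have htt' : t = t' := Fin.ext htt
  subst htt'
  refine ⟨rfl, fun s hs => ?_⟩
  have haa : a = a' := Fin.ext (by omega)
  have := congrFun (finFunctionFinEquiv.injective haa) s
  simpa [hs] using this

theorem codeAt_lt {B : ℕ} (t : Fin N) (q : Fin N → Fin (B + 1)) : ∃ n < (N + 1) * (B + 1) ^ N,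
    codeAt (B + 1) t (fun s => ((q s : ℕ) : ℝ)) = (n : ℝ) := by
  refine ⟨_, ?_, codeAt_eq_natCast t q⟩
  have h1 := (finFunctionFinEquiv (fun s => if s ≤ t then q s else 0)).2
  have h2 : (t : ℕ) * (B + 1) ^ N ≤ N * (B + 1) ^ N := Nat.mul_le_mul_right _ t.2.le
  have h3 : (N + 1) * (B + 1) ^ N = N * (B + 1) ^ N + (B + 1) ^ N := by ring
  omega

/-- Finitely many values at the natural numbers are attained by a bounded continuous function. -/
theorem exists_continuous_eq_natCast {V : Type*} [NormedAddCommGroup V] [NormedSpace ℝ V] (M : ℕ)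
    (a : ℕ → V) : ∃ Ψ : ℝ → V, Continuous Ψ ∧ (∃ C, ∀ s, ‖Ψ s‖ ≤ C) ∧ ∀ n < M, Ψ n = a n := by
  -- A sum of hat functions, each of which vanishes at all integers but its own.
  refine ⟨fun s => ∑ n ∈ Finset.range M, max 0 (1 - |s - n|) • a n, by fun_prop,
    ⟨∑ n ∈ Finset.range M, ‖a n‖, fun s => ?_⟩, fun n hn => ?_⟩
  · refine norm_sum_le_of_le _ fun n _ => ?_
    rw [norm_smul]
    refine mul_le_of_le_one_left (norm_nonneg _) ?_
    rw [Real.norm_of_nonneg (le_max_left _ _)]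
    exact max_le zero_le_one (by linarith [abs_nonneg (s - n)])
  · beta_reduce
    rw [Finset.sum_eq_single_of_mem n (Finset.mem_range.2 hn) fun k _ hk => ?_]
    · simp
    · have h1 : (1 : ℝ) ≤ |(n : ℝ) - k| := by
        have : (1 : ℤ) ≤ |(n : ℤ) - k| := Int.one_le_abs (by omega)
        exact_mod_cast this
      rw [max_eq_left (by linarith), zero_smul]

/-- A compact set has a finite measurable partition into sets of small diameter. -/
theorem exists_measurable_quantizer {E : Type*} [PseudoMetricSpace E] [TopologicalSpace.SeparableSpace E]
    [Nonempty E] [MeasurableSpace E] [OpensMeasurableSpace E] {K : Set E} (hK : IsCompact K) {δ : ℝ}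
    (hδ : 0 < δ) : ∃ (B : ℕ) (q : E → Fin (B + 1)), Measurable q ∧
      ∀ x ∈ K, ∀ y ∈ K, q x = q y → dist x y < δ := by
  -- A point is quantized to the nearest of the first `B + 1` points of a dense sequence, with `B`
  -- found by compactness of `K`.
  let e := TopologicalSpace.denseSeq E
  have hcover : K ⊆ ⋃ n, ⋃ k ≤ n, Metric.ball (e k) (δ / 2) := fun x _ => by
    obtain ⟨k, hk⟩ := (TopologicalSpace.denseRange_denseSeq E).exists_dist_lt x (half_pos hδ)
    exact Set.mem_iUnion.2 ⟨k, Set.mem_iUnion₂.2 ⟨k, le_rfl, hk⟩⟩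
  obtain ⟨B, hB⟩ := hK.elim_directed_cover _
    (fun n => isOpen_biUnion fun k _ => Metric.isOpen_ball) hcover
    (directed_of_isDirected_le fun m n hmn =>
      Set.biUnion_subset_biUnion_left fun k hk => le_trans hk hmn)
  have hnear (x) (hx : x ∈ K) : dist (SimpleFunc.nearestPt e B x) x < δ / 2 := by
    obtain ⟨k, hk, hxk⟩ := Set.mem_iUnion₂.1 (hB hx)
    have h := SimpleFunc.edist_nearestPt_le e x hk
    rw [edist_dist, edist_dist, ENNReal.ofReal_le_ofReal_iff dist_nonneg] at h
    rw [Metric.mem_ball, dist_comm] at hxk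
    exact h.trans_lt hxk
  have hle (x : E) : SimpleFunc.nearestPtInd e B x < B + 1 :=
    Nat.lt_succ_of_le (SimpleFunc.nearestPtInd_le e B x)
  refine ⟨B, fun x => ⟨SimpleFunc.nearestPtInd e B x, hle x⟩, ?_, fun x hx y hy hxy => ?_⟩
  · refine measurable_to_countable' fun i => ?_
    have : (fun x => (⟨SimpleFunc.nearestPtInd e B x, hle x⟩ : Fin (B + 1))) ⁻¹' {i} =
        SimpleFunc.nearestPtInd e B ⁻¹' {(i : ℕ)} := by
      ext x
      simp [Fin.ext_iff]
    rw [this]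
    exact SimpleFunc.measurableSet_fiber _ _
  · have h : SimpleFunc.nearestPt e B x = SimpleFunc.nearestPt e B y := by
      simp only [SimpleFunc.nearestPt, SimpleFunc.map_apply]
      rw [Fin.mk.inj hxy]
    have h1 := hnear x hx
    have h2 := hnear y hy
    rw [← h] at h2
    linarith [dist_triangle_left x y (SimpleFunc.nearestPt e B x)]

/-- On a compact set, continuous causal functions almost factor through a code. -/
theorem exists_code {E V : Type*} [PseudoMetricSpace E] [TopologicalSpace.SeparableSpace E]
    [Nonempty E] [MeasurableSpace E] [OpensMeasurableSpace E] [NormedAddCommGroup V]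
    [NormedSpace ℝ V] {K : Set E} (hK : IsCompact K) {g : (Fin N → E) → Fin N → V}
    (hgc : Continuous g) (hg : Causal g) {ε : ℝ} (hε : 0 < ε) :
    ∃ (B : ℕ) (q : E → Fin (B + 1)) (Ψ : ℝ → V), Measurable q ∧ Continuous Ψ ∧
      (∃ C, ∀ s, ‖Ψ s‖ ≤ C) ∧ ∀ x ∈ Set.univ.pi fun _ => K, ∀ t,
        ‖g x t - Ψ (codeAt (B + 1) t fun s => ((q (x s) : ℕ) : ℝ))‖ ≤ ε := by
  have hKN : IsCompact (Set.univ.pi fun _ : Fin N => K) := isCompact_univ_pi fun _ => hK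
  obtain ⟨δ, hδ, hunif⟩ := Metric.uniformContinuousOn_iff.1
    (hKN.uniformContinuousOn_of_continuous hgc.continuousOn) ε hε
  obtain ⟨B, q, hq, hqK⟩ := exists_measurable_quantizer hK hδ
  let code (x : Fin N → E) (t : Fin N) : ℝ := codeAt (B + 1) t fun s => ((q (x s) : ℕ) : ℝ)
  have hclose (x) (hx : x ∈ Set.univ.pi fun _ => K) (x') (hx' : x' ∈ Set.univ.pi fun _ => K)
      (t t' : Fin N) (h : code x t = code x' t') : ‖g x t - g x' t'‖ ≤ ε := by
    obtain ⟨rfl, hqq⟩ := codeAt_injective h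
    -- Equal codes control only the past. Causality lets the future of `x'` be replaced by that of
    -- `x`, and the result is uniformly close to `x`.
    have h1 : g x' t = g (splice t x' x) t := hg _ _ t fun s hs => (if_pos hs).symm
    rw [h1, ← dist_eq_norm]
    refine (dist_le_pi_dist _ _ t).trans (hunif _ hx _ (fun s _ => ?_) ?_).le
    · by_cases hs : s ≤ t <;> simp [splice, hs]
      exacts [hx' s trivial, hx s trivial]
    · refine (dist_pi_lt_iff hδ).2 fun s => ?_
      by_cases hs : s ≤ t
      · simpa [splice, hs] using hqK _ (hx s trivial) _ (hx' s trivial) (hqq s hs)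
      · simpa [splice, hs] using hδ
  -- The value of `g` at one representative serves for all points with code `n`; numbers that are
  -- not codes get the value `0`.
  have hval (n : ℕ) : ∃ v : V, ∀ x ∈ Set.univ.pi fun _ => K, ∀ t, code x t = n →
      ‖g x t - v‖ ≤ ε := by
    by_cases h : ∃ x ∈ Set.univ.pi fun _ => K, ∃ t : Fin N, code x t = n
    · obtain ⟨x', hx', t', h'⟩ := h
      exact ⟨g x' t', fun x hx t ht => hclose x hx x' hx' t t' (ht.trans h'.symm)⟩
    · exact ⟨0, fun x hx t ht => (h ⟨x, hx, t, ht⟩).elim⟩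
  choose a ha using hval
  obtain ⟨Ψ, hΨc, hΨb, hΨ⟩ := exists_continuous_eq_natCast ((N + 1) * (B + 1) ^ N) a
  refine ⟨B, q, Ψ, hq, hΨc, hΨb, fun x hx t => ?_⟩
  obtain ⟨n, hn, hcode⟩ := codeAt_lt t fun s => q (x s)
  rw [hcode, hΨ n hn]
  exact ha n x hx t hcode

/-- Bounded functions that converge almost everywhere converge in `L^p`. -/
theorem tendsto_eLpNorm_of_bounded {α V : Type*} [MeasurableSpace α] [NormedAddCommGroup V]
    {μ : Measure α} [IsFiniteMeasure μ] {p : ℝ≥0∞} (hp0 : p ≠ 0) (hp : p ≠ ∞) {h : ℕ → α → V}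
    (hm : ∀ n, AEStronglyMeasurable (h n) μ) {C : ℝ} (hC : ∀ n x, ‖h n x‖ ≤ C)
    (hlim : ∀ᵐ x ∂μ, Tendsto (fun n => h n x) atTop (𝓝 0)) :
    Tendsto (fun n => eLpNorm (h n) p μ) atTop (𝓝 0) := by
  have hpos : 0 < p.toReal := ENNReal.toReal_pos hp0 hp
  have key : Tendsto (fun n => ∫⁻ x, ‖h n x‖ₑ ^ p.toReal ∂μ) atTop (𝓝 (∫⁻ _, 0 ∂μ)) := by
    refine tendsto_lintegral_of_dominated_convergence' (fun _ => ENNReal.ofReal C ^ p.toReal)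
      (fun n => (hm n).enorm.pow_const _) (fun n => ?_) ?_ ?_
    · refine Eventually.of_forall fun x => ENNReal.rpow_le_rpow ?_ hpos.le
      rw [← ofReal_norm]
      exact ENNReal.ofReal_le_ofReal (hC n x)
    · rw [lintegral_const]
      exact ENNReal.mul_ne_top (ENNReal.rpow_ne_top_of_nonneg hpos.le ENNReal.ofReal_ne_top)
        (measure_ne_top _ _)
    · filter_upwards [hlim] with x hx
      have h1 := (ENNReal.continuous_rpow_const (y := p.toReal)).tendsto 0 |>.comp
        (by simpa using hx.enorm)
      simpa [hpos, Function.comp_def] using h1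
  have h2 := (ENNReal.continuous_rpow_const (y := 1 / p.toReal)).tendsto _ |>.comp key
  simp only [lintegral_zero] at h2
  rw [ENNReal.zero_rpow_of_pos (by positivity)] at h2
  refine h2.congr fun n => ?_
  rw [eLpNorm_eq_lintegral_rpow_enorm_toReal hp0 hp]
  rfl

/-- Bounded measurable functions are limits almost everywhere of continuous functions. -/
theorem exists_seq_continuous_tendsto_ae {E : Type*} [PseudoMetricSpace E] [MeasurableSpace E]
    [BorelSpace E] (ν : Measure E) [IsFiniteMeasure ν] {q : E → ℝ} (hq : Measurable q) {C : ℝ}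
    (hC : ∀ x, ‖q x‖ ≤ C) : ∃ φ : ℕ → E → ℝ, (∀ n, Continuous (φ n)) ∧
      ∀ᵐ x ∂ν, Tendsto (fun n => φ n x) atTop (𝓝 (q x)) := by
  have hmem : MemLp q 1 ν := MemLp.of_bound hq.aestronglyMeasurable C (Eventually.of_forall hC)
  -- Continuous approximation in `L^1` gives convergence in measure, and then almost everywhere
  -- along a subsequence.
  choose g hg _ using fun n : ℕ => hmem.exists_boundedContinuous_eLpNorm_sub_le
    ENNReal.one_ne_top (ε := (n : ℝ≥0∞)⁻¹) (by simp)
  have htends : Tendsto (fun n => eLpNorm (⇑(g n) - q) 1 ν) atTop (𝓝 0) := by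
    refine tendsto_of_tendsto_of_tendsto_of_le_of_le tendsto_const_nhds
      ENNReal.tendsto_inv_nat_nhds_zero (fun _ => zero_le) fun n => ?_
    rw [eLpNorm_sub_comm]
    exact hg n
  obtain ⟨ns, -, hns⟩ := (tendstoInMeasure_of_tendsto_eLpNorm one_ne_zero
    (fun n => (g n).continuous.aestronglyMeasurable) hq.aestronglyMeasurable
    htends).exists_seq_tendsto_ae
  exact ⟨fun n => g (ns n), fun n => (g (ns n)).continuous, hns⟩

/-- Continuous causal functions are approximated in `L^p` by functions that factor through a
real-valued continuous causal code. -/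
theorem exists_continuous_code_near {E V : Type*} [PseudoMetricSpace E]
    [Nonempty E] [MeasurableSpace E] [BorelSpace E] [SecondCountableTopology E]
    [NormedAddCommGroup V] [NormedSpace ℝ V] (ν : Measure E) [IsFiniteMeasure ν] {K : Set E}
    (hK : IsCompact K) (hνK : ∀ᵐ x ∂ν, x ∈ K) {p : ℝ≥0∞} (hp1 : 1 ≤ p)
    (hp : p ≠ ∞) {g : (Fin N → E) → Fin N → V} (hgc : Continuous g) (hg : Causal g)
    {δ : ℝ≥0∞} (hδ : δ ≠ 0) : ∃ (u : (Fin N → E) → Fin N → ℝ) (Ψ : ℝ → V), Continuous u ∧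
      Causal u ∧ Continuous Ψ ∧ ∀ t,
      eLpNorm (fun x => g x t - Ψ (u x t)) p (Measure.pi fun _ : Fin N => ν) ≤ δ := by
  set μ := Measure.pi fun _ : Fin N => ν with hμ
  have hp0 : p ≠ 0 := (zero_lt_one.trans_le hp1).ne'
  have hhalf : δ / 2 ≠ 0 := by simp [hδ]
  have hfin : μ Set.univ ^ p.toReal⁻¹ ≠ ∞ :=
    ENNReal.rpow_ne_top_of_nonneg (by positivity) (measure_ne_top _ _)
  -- A uniform error `η` has `L^p` norm at most `μ univ ^ (1 / p) * η`.
  obtain ⟨η, hη, hηδ⟩ := ENNReal.exists_nnreal_pos_mul_lt hfin hhalf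
  obtain ⟨B, q, Ψ, hq, hΨc, ⟨C, hC⟩, hΨ⟩ := exists_code hK hgc hg (NNReal.coe_pos.2 hη)
  obtain ⟨φ, hφc, hφ⟩ := exists_seq_continuous_tendsto_ae ν (q := fun x => ((q x : ℕ) : ℝ))
    ((measurable_of_countable fun i : Fin (B + 1) => ((i : ℕ) : ℝ)).comp hq) (C := B) fun x => by
      simpa using Nat.lt_succ_iff.1 (q x).2
  let c (x : Fin N → E) (t : Fin N) : ℝ := codeAt (B + 1) t fun s => ((q (x s) : ℕ) : ℝ)
  let u (n : ℕ) (x : Fin N → E) (t : Fin N) : ℝ := codeAt (B + 1) t fun s => φ n (x s)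
  have hucont (n) : Continuous (u n) :=
    continuous_pi fun t => (continuous_codeAt _ t).comp (by have := hφc n; fun_prop)
  have hΨu (n) (t : Fin N) : AEStronglyMeasurable (fun x => Ψ (u n x t)) μ :=
    (hΨc.comp ((continuous_apply t).comp (hucont n))).aestronglyMeasurable
  have hΨm (t : Fin N) : AEStronglyMeasurable (fun x => Ψ (c x t)) μ := by
    refine hΨc.comp_aestronglyMeasurable (Measurable.aestronglyMeasurable ?_)
    refine (continuous_codeAt _ t).measurable.comp (measurable_pi_lambda _ fun s => ?_)
    exact (measurable_of_countable fun i : Fin (B + 1) => ((i : ℕ) : ℝ)).comp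
      (hq.comp (measurable_pi_apply s))
  have hφ' : ∀ᵐ x ∂μ, ∀ s, Tendsto (fun n => φ n (x s)) atTop (𝓝 ((q (x s) : ℕ) : ℝ)) :=
    eventually_all.2 fun s => (Measure.tendsto_eval_ae_ae (μ := fun _ : Fin N => ν) (i := s)).eventually hφ
  have hK' : ∀ᵐ x ∂μ, x ∈ Set.univ.pi fun _ : Fin N => K :=
    (eventually_all.2 fun s => (Measure.tendsto_eval_ae_ae (μ := fun _ : Fin N => ν) (i := s)).eventually hνK).mono
      fun x hx s _ => hx s
  -- The code depends continuously on its digits and `Ψ` is bounded and continuous, so dominated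
  -- convergence applies.
  have hlim (t : Fin N) : Tendsto (fun n => eLpNorm (fun x => Ψ (c x t) - Ψ (u n x t)) p μ)
      atTop (𝓝 0) := by
    refine tendsto_eLpNorm_of_bounded hp0 hp (fun n => (hΨm t).sub (hΨu n t)) (C := C + C)
      (fun n x => (norm_sub_le _ _).trans (add_le_add (hC _) (hC _))) ?_
    filter_upwards [hφ'] with x hx
    have h1 : Tendsto (fun n => Ψ (u n x t)) atTop (𝓝 (Ψ (c x t))) :=
      ((hΨc.comp (continuous_codeAt (B + 1) t)).tendsto _).comp (tendsto_pi_nhds.2 hx)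
    simpa using h1.const_sub (Ψ (c x t))
  obtain ⟨n, hn⟩ := (eventually_all.2 fun t => (hlim t).eventually_le_const
    (pos_iff_ne_zero.2 hhalf)).exists
  refine ⟨u n, Ψ, hucont n, fun x y t h => codeAt_congr _ t fun s hs => by rw [h s hs], hΨc,
    fun t => ?_⟩
  have h1 : eLpNorm (fun x => g x t - Ψ (c x t)) p μ ≤ δ / 2 := by
    refine (eLpNorm_le_of_ae_bound (C := η) (hK'.mono fun x hx => hΨ x hx t)).trans ?_
    rw [ENNReal.ofReal_coe_nnreal, mul_comm]
    exact hηδ.le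
  have hgm : AEStronglyMeasurable (fun x => g x t) μ :=
    ((continuous_apply t).comp hgc).aestronglyMeasurable
  have h2 := eLpNorm_add_le (hgm.sub (hΨm t)) ((hΨm t).sub (hΨu n t)) hp1
  calc eLpNorm (fun x => g x t - Ψ (u n x t)) p μ
      = eLpNorm ((fun x => g x t - Ψ (c x t)) + fun x => Ψ (c x t) - Ψ (u n x t)) p μ := by
        congr 1
        funext x
        simp
    _ ≤ δ / 2 + δ / 2 := h2.trans (add_le_add h1 (hn t))
    _ = δ := ENNReal.add_halves δ

end Code

/-! ### Assembly of the two claims -/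

theorem isCompact_seqSet {dx N : ℕ} {K : Set (EuclideanSpace ℝ (Fin dx))} (hK : IsCompact K) :
    IsCompact (seqSet N K) :=
  isCompact_univ_pi fun _ => hK

theorem volume_restrict_seqSet {dx N : ℕ} (K : Set (EuclideanSpace ℝ (Fin dx))) :
    (volume : Measure (Fin N → EuclideanSpace ℝ (Fin dx))).restrict (seqSet N K) =
      Measure.pi fun _ => volume.restrict K := by
  rw [seqSet, volume_pi, Measure.restrict_pi_pi]

theorem mainTheorem6 (dx dy N : ℕ) (hdx : 1 ≤ dx) (hdy : 1 ≤ dy) (hN : 1 ≤ N) :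
    (∀ f : (Fin N → EuclideanSpace ℝ (Fin dx)) → (Fin N → EuclideanSpace ℝ (Fin dy)),
      Continuous f → PastDependent f →
      ∀ ε : ℝ, 0 < ε → ∀ K : Set (EuclideanSpace ℝ (Fin dx)), IsCompact K →
      ∃ 𝒩 : LSTMNetwork dx dy (dx + dy + 3), 𝒩.IsDeep ∧
        (⨆ x ∈ seqSet N K, ⨆ t : Fin N, ‖f x t - 𝒩.eval x t‖ₑ) < ENNReal.ofReal ε) ∧
    (∀ p : ℝ≥0∞, 1 ≤ p → p ≠ ∞ →
      ∀ f : (Fin N → EuclideanSpace ℝ (Fin dx)) → (Fin N → EuclideanSpace ℝ (Fin dy)),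
      PastDependent f →
      ∀ ε : ℝ, 0 < ε → ∀ K : Set (EuclideanSpace ℝ (Fin dx)), IsCompact K →
      MemLp f p (volume.restrict (seqSet N K)) →
      ∃ 𝒩 : LSTMNetwork dx dy (max (dx + 1) dy + 1), 𝒩.IsDeep ∧
        (⨆ t : Fin N, eLpNorm (fun x => f x t - 𝒩.eval x t) p (volume.restrict (seqSet N K))) <
          ENNReal.ofReal ε) := by
  refine ⟨fun f hfc hf ε hε K hK => ?_, fun p hp1 hp f hf ε hε K hK hfp => ?_⟩
  · obtain ⟨𝒩, hdeep, h𝒩⟩ :=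
      exists_isDeep_near_of_continuous hfc hf.causal (isCompact_seqSet hK) (half_pos hε)
    refine ⟨𝒩, hdeep, lt_of_le_of_lt (iSup₂_le fun x hx => iSup_le fun t => ?_)
      ((ENNReal.ofReal_lt_ofReal_iff hε).2 (half_lt_self hε))⟩
    rw [← ofReal_norm]
    exact ENNReal.ofReal_le_ofReal (h𝒩 x hx t).le
  · have hp0 : p ≠ 0 := (zero_lt_one.trans_le hp1).ne'
    have hδ : ENNReal.ofReal (ε / 4) ≠ 0 := by simpa using hε
    -- Three errors of size `ε / 4` occur: making `f` continuous, passing to the code, and the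
    -- network. Their sum leaves room for the strict inequality of the supremum.
    set δ := ENNReal.ofReal (ε / 4) with hδdef
    have hmeasure := volume_restrict_seqSet (N := N) K
    have : IsFiniteMeasure ((volume : Measure (EuclideanSpace ℝ (Fin dx))).restrict K) :=
      ⟨by simpa using hK.measure_lt_top⟩
    rw [hmeasure] at hfp ⊢
    set ν := (volume : Measure (EuclideanSpace ℝ (Fin dx))).restrict K with hν
    set μ := Measure.pi fun _ : Fin N => ν with hμ
    obtain ⟨g, hgc, hg, hfg⟩ := exists_continuous_causal_near ν hp0 hp hf.causal hfp hδ
    obtain ⟨u, Ψ, huc, hu, hΨ, hgu⟩ := exists_continuous_code_near ν hK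
      (ae_restrict_mem hK.measurableSet) hp1 hp hgc hg hδ
    have hfin : μ Set.univ ^ p.toReal⁻¹ ≠ ∞ :=
      ENNReal.rpow_ne_top_of_nonneg (by positivity) (measure_ne_top _ _)
    obtain ⟨η, hη, hηδ⟩ := ENNReal.exists_nnreal_pos_mul_lt hfin hδ
    obtain ⟨𝒩, hdeep, h𝒩⟩ := exists_isDeep_near_of_code huc hu hΨ (isCompact_seqSet (N := N) hK)
      (NNReal.coe_pos.2 hη)
    refine ⟨𝒩, hdeep, lt_of_le_of_lt (iSup_le fun t => ?_)
      ((ENNReal.ofReal_lt_ofReal_iff hε).2 (show 3 * (ε / 4) < ε by linarith))⟩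
    have hmem : ∀ᵐ x ∂μ, x ∈ seqSet N K := by
      rw [← hmeasure]
      exact ae_restrict_mem (isCompact_seqSet hK).measurableSet
    have hfm : AEStronglyMeasurable (fun x => f x t - g x t) μ :=
      (memLp_pi_iff.1 hfp t).1.sub ((continuous_apply t).comp hgc).aestronglyMeasurable
    have hgm : AEStronglyMeasurable (fun x => g x t - Ψ (u x t)) μ :=
      (((continuous_apply t).comp hgc).sub
        (hΨ.comp ((continuous_apply t).comp huc))).aestronglyMeasurable
    calc eLpNorm (fun x => f x t - 𝒩.eval x t) p μ
        ≤ eLpNorm ((fun x => ‖f x t - g x t‖) + (fun x => ‖g x t - Ψ (u x t)‖) +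
            fun _ => (η : ℝ)) p μ := by
          refine eLpNorm_mono_ae_real (hmem.mono fun x hx => ?_)
          have h1 := norm_sub_le_norm_sub_add_norm_sub (f x t) (g x t) (𝒩.eval x t)
          have h2 := norm_sub_le_norm_sub_add_norm_sub (g x t) (Ψ (u x t)) (𝒩.eval x t)
          have h3 := h𝒩 x hx t
          simp only [Pi.add_apply]
          linarith
      _ ≤ δ + δ + δ := by
          refine (eLpNorm_add_le (hfm.norm.add hgm.norm) aestronglyMeasurable_const hp1).trans
            (add_le_add ((eLpNorm_add_le hfm.norm hgm.norm hp1).trans (add_le_add ?_ ?_)) ?_)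
          · rw [eLpNorm_norm]
            exact hfg t
          · rw [eLpNorm_norm]
            exact hgu t
          · refine (eLpNorm_le_of_ae_bound (C := η) (Eventually.of_forall fun x => by simp)).trans ?_
            rw [ENNReal.ofReal_coe_nnreal, mul_comm]
            exact hηδ.le
      _ = ENNReal.ofReal (3 * (ε / 4)) := by
          rw [hδdef, ← ENNReal.ofReal_add (by positivity) (by positivity),
            ← ENNReal.ofReal_add (by positivity) (by positivity)]
          congr 1
          ring
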